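/- Let $\mathbb F$ be a field of characteristic $p>3$, let $n\ge 3$, and let $\underline t=(t_1,\dots,t_n)$ be positive integers. Let $\mathcal O(n,n)=\mathcal O(n)\otimes\Lambda(n)$ be the associative superalgebra over $\mathbb F$ with basis $\{x^{(\alpha)}x^u\}$, where $\mathcal O(n)$ is the divided power algebra with basis $x^{(\alpha)}$, $\alpha\in\mathbb N_0^n$ (so $x^{(\alpha)}x^{(\beta)}=\prod_i\binom{\alpha_i+\beta_i}{\alpha_i}\,x^{(\alpha+\beta)}$), and $\Lambda(n)$ is the exterior algebra in $x_{n+1},\dots,x_{2n}$ with basis $x^u=x_{i_1}\cdots x_{i_k}$, $u=\{i_1<\dots<i_k\}\subseteq\{n+1,\dots,2n\}$. Write $x_i=x^{(\varepsilon_i)}$ for $i\le n$. Let $\mathcal O(n,n;\underline t)$ be the subalgebra spanned by the $x^{(\alpha)}x^u$ with $\alpha_i\le p^{t_i}-1$ for all $i$; it is $\mathbb Z_2$-graded by the parity $\mathrm p(x^{(\alpha)}x^u)=|u| \bmod 2$ and $\mathbb Z$-graded by $\deg x^{(\alpha)}x^u=|\alpha|+|u|$. Put $\mu(r)=\bar 0$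 for $1\le r\le n$ and $\mu(r)=\bar 1$ for $n<r\le 2n$. Let $\partial_1,\dots,\partial_{2n}$ be the superderivations $\partial_r(x^{(\alpha)}x^u)=x^{(\alpha-\varepsilon_r)}x^u$ for $r\le n$ (which is $0$ if $\alpha_r=0$) and $\partial_r(x^{(\alpha)}x^u)=x^{(\alpha)}\,\partial x^u/\partial x_r$ for $r>n$. Let $W(n,n;\underline t)=\{\sum_{r=1}^{2n}f_r\partial_r : f_r\in\mathcal O(n,n;\underline t)\}$ be the generalized Witt Lie superalgebra, in which $f\partial_r$ has parity $\mathrm p(f)+\mu(r)$ and $\mathbb Z$-degree $\deg f-1$. For $1\le i\le 2n$ let $i'=i+n$ if $i\le n$ and $i'=i-n$ if $i>n$, and let $\mathrm{T_H}:\mathcal O(n,n;\underline t)\to W(n,n;\underline t)$ be the linear map with $$\mathrm{T_H}(a)=\sum_{i=1}^{2n}(-1)^{\mu(i)\mathrm p(a)}\,\partial_i(a)\,\partial_{i'}\qquad\text{for homogeneous } a .$$ Its image $HO(n,n;\underline t)$ is a $\mathbb Z$-graded Lie sub-superalgebra of $W(n,n;\underline t)$, the odd Hamiltonian superalgebra.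 Let $\mathcal W=\bigoplus_i\mathcal W_i$ and $\mathcal{HO}=\bigoplus_i\mathcal{HO}_i$ denote the even parts of $W(n,n;\underline t)$ and $HO(n,n;\underline t)$; these are $\mathbb Z$-graded Lie algebras, and $\mathcal{HO}_i=\mathcal{HO}\cap\mathcal W_i$. A derivation from $\mathcal{HO}$ into $\mathcal W$ is a linear map $D:\mathcal{HO}\to\mathcal W$ with $D([x,y])=[x,D(y)]-[y,D(x)]$ for all $x,y\in\mathcal{HO}$. For $d\in\mathbb Z$ let $\mathrm{Der}_d(\mathcal{HO},\mathcal W)$ be the space of those derivations with $D(\mathcal{HO}_i)\subseteq\mathcal W_{d+i}$ for all $i\in\mathbb Z$. Then for every integer $d\ge 0$ $$\mathrm{Der}_d(\mathcal{HO},\mathcal W)=\mathrm{ad}\,\mathcal W_d=\{\,(x\mapsto[E,x])|_{\mathcal{HO}} : E\in\mathcal W_d\,\};$$ in particular, every derivation of $\mathbb Z$-degree $d\ge 0$ from $\mathcal{HO}$ into $\mathcal W$ is inner. -/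

import Mathlib

noncomputable section

namespace OddHamiltonian

open Finset

/-! ### The superalgebra `𝒪(n,n)` -/

/-- The index `(α, u)` of the standard monomial `x^(α) x^u` of `𝒪(n,n)`: the exponent `α` of the
divided powers of `x_1, …, x_n`, and the set `u` of the odd variables that occur; the element
`k : Fin n` of `u` stands for the `k`-th odd variable, `x_{n+k}`. -/
abbrev Mono (n : ℕ) : Type := (Fin n → ℕ) × Finset (Fin n)

/-- The vector space `𝒪(n,n) = 𝒪(n) ⊗ Λ(n)` with basis the monomials `x^(α) x^u`. -/
abbrev DPS (F : Type*) [Field F] (n : ℕ) : Type _ := Mono n →₀ F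

/-- The index set `Y = Y₀ ∪ Y₁`: `Sum.inl i` is the `i`-th even index `i ∈ Y₀`, and `Sum.inr i` is
the odd index `i' = i + n ∈ Y₁`. The involution `r ↦ r'` of `Y` is `Sum.swap`. -/
abbrev Ind (n : ℕ) : Type := Fin n ⊕ Fin n

/-- The parity `μ` of an index: `0` on `Y₀` and `1` on `Y₁`. -/
def par {n : ℕ} : Ind n → ℕ
  | Sum.inl _ => 0
  | Sum.inr _ => 1

/-- The sign in `x_i x_j = ± x^{{i, j}}` for odd variables, `0` if `i = j`. -/
def pairSign {n : ℕ} (i j : Fin n) : ℤ := if i < j then 1 else if j < i then -1 else 0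

/-- The sign in `x^u x^v = ± x^{u ∪ v}`: it is `(-1)` to the number of pairs `(i, j) ∈ u × v` with
`j < i` if `u` and `v` are disjoint, and `0` otherwise. -/
def wedgeSign {n : ℕ} (u v : Finset (Fin n)) : ℤ := ∏ i ∈ u, ∏ j ∈ v, pairSign i j

/-- The structure constants of `𝒪(n,n)`:
`x^(α) x^u · x^(β) x^v = (∏ i, (α_i + β_i choose α_i)) (± 1 or 0) x^(α+β) x^{u ∪ v}`. -/
def mulCoeff {n : ℕ} (a b : Mono n) : ℤ :=
  ((∏ i, (a.1 i + b.1 i).choose (a.1 i) : ℕ) : ℤ) * wedgeSign a.2 b.2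

/-- The multiplication of the associative superalgebra `𝒪(n,n)`. -/
def mul (F : Type*) [Field F] (n : ℕ) : DPS F n →ₗ[F] DPS F n →ₗ[F] DPS F n :=
  Finsupp.linearCombination F fun a : Mono n =>
    Finsupp.linearCombination F fun b : Mono n =>
      (Finsupp.single (a.1 + b.1, a.2 ∪ b.2) ((mulCoeff a b : ℤ) : F) : DPS F n)

/-- The superderivations `∂_r`, `r ∈ Y`, of `𝒪(n,n)`:
`∂_i (x^(α) x^u) = x^(α - ε_i) x^u` for `i ∈ Y₀` (to be read as `0` if `α_i = 0`), and
`∂_k (x^(α) x^u) = x^(α) ∂x^u/∂x_k` for `k ∈ Y₁`. -/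
def pd (F : Type*) [Field F] (n : ℕ) : Ind n → (DPS F n →ₗ[F] DPS F n)
  | Sum.inl i => Finsupp.linearCombination F fun a : Mono n =>
      if a.1 i = 0 then 0 else (Finsupp.single (a.1 - Pi.single i 1, a.2) 1 : DPS F n)
  | Sum.inr k => Finsupp.linearCombination F fun a : Mono n =>
      if k ∈ a.2 then
        (Finsupp.single (a.1, a.2.erase k) ((-1) ^ #{j ∈ a.2 | j < k}) : DPS F n)
      else 0

/-- The homogeneous components of `𝒪(n,n)` for the `ℤ/2`-grading; `e` is read modulo `2`. -/
def parityPart (F : Type*) [Field F] (n : ℕ) (e : ℕ) : Submodule F (DPS F n) :=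
  Finsupp.supported F F {a : Mono n | #a.2 ≡ e [MOD 2]}

/-- The span of the monomials `x^(α) x^u` with `|α| + |u| = d`. -/
def degPart (F : Type*) [Field F] (n : ℕ) (d : ℤ) : Submodule F (DPS F n) :=
  Finsupp.supported F F {a : Mono n | ((∑ i, a.1 i + #a.2 : ℕ) : ℤ) = d}

/-- The truncated superalgebra `𝒪(n,n;t)`, spanned by the `x^(α) x^u` with
`α_i ≤ π_i = p^{t_i} - 1` for all `i`. -/
def trunc (F : Type*) [Field F] {n : ℕ} (p : ℕ) (t : Fin n → ℕ) : Submodule F (DPS F n) :=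
  Finsupp.supported F F {a : Mono n | ∀ i, a.1 i ≤ p ^ t i - 1}

/-! ### Vector fields -/

/-- The operator `∑_{r ∈ Y} f_r ∂_r` on `𝒪(n,n)` with coefficients `f_r ∈ 𝒪(n,n)`. -/
def vf (F : Type*) [Field F] (n : ℕ) : (Ind n → DPS F n) →ₗ[F] Module.End F (DPS F n) where
  toFun f := ∑ r, mul F n (f r) ∘ₗ pd F n r
  map_add' f g := by simp [LinearMap.add_comp, Finset.sum_add_distrib]
  map_smul' c f := by simp [LinearMap.smul_comp, Finset.smul_sum]

/-- The even part of `W(n,n;t)`: since `f ∂_r` has parity `p(f) + μ(r)`, it consists of the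
`∑ f_r ∂_r` with `f_r ∈ 𝒪(n,n;t)` of parity `μ(r)`. -/
def wittEvenSub (F : Type*) [Field F] {n : ℕ} (p : ℕ) (t : Fin n → ℕ) :
    Submodule F (Module.End F (DPS F n)) :=
  (Submodule.pi Set.univ fun r : Ind n => trunc F p t ⊓ parityPart F n (par r)).map (vf F n)

/-- The component `W(n,n;t)_d` of the `ℤ`-grading of `W(n,n;t)`, that is, the span of the `f ∂_r`
with `f ∈ 𝒪(n,n;t)` of degree `d + 1`. -/
def wittDeg (F : Type*) [Field F] {n : ℕ} (p : ℕ) (t : Fin n → ℕ) (d : ℤ) :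
    Submodule F (Module.End F (DPS F n)) :=
  (Submodule.pi Set.univ fun _ : Ind n => trunc F p t ⊓ degPart F n (d + 1)).map (vf F n)

/-- The linear map that multiplies a homogeneous element `a` by `(-1)^{μ(r) p(a)}`. -/
def twist (F : Type*) [Field F] (n : ℕ) (r : Ind n) : DPS F n →ₗ[F] DPS F n :=
  Finsupp.linearCombination F fun a : Mono n =>
    (Finsupp.single a ((-1) ^ (par r * #a.2)) : DPS F n)

/-- The map `T_H(a) = ∑_{i ∈ Y} (-1)^{μ(i) p(a)} ∂_i(a) ∂_{i'}`. -/
def TH (F : Type*) [Field F] (n : ℕ) : DPS F n →ₗ[F] Module.End F (DPS F n) where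
  toFun a := ∑ i : Ind n, mul F n (pd F n i (twist F n i a)) ∘ₗ pd F n i.swap
  map_add' f g := by simp [LinearMap.add_comp, Finset.sum_add_distrib]
  map_smul' c f := by simp [LinearMap.smul_comp, Finset.smul_sum]

/-- The odd Hamiltonian superalgebra `HO(n,n;t)`, the set of all `T_H(a)`, `a ∈ 𝒪(n,n;t)`. -/
def hoSub (F : Type*) [Field F] {n : ℕ} (p : ℕ) (t : Fin n → ℕ) :
    Submodule F (Module.End F (DPS F n)) :=
  (trunc F p t).map (TH F n)

/-! ### Closure under the commutator -/

section Combinatorics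

variable {n : ℕ}

theorem pairSign_self (i : Fin n) : pairSign i i = 0 := by simp [pairSign]

theorem pairSign_swap (i j : Fin n) : pairSign i j = -pairSign j i := by
  rcases lt_trichotomy i j with h | h | h
  · simp [pairSign, h, h.not_gt]
  · simp [pairSign, h]
  · simp [pairSign, h, h.not_gt]

theorem pairSign_sq {i j : Fin n} (h : i ≠ j) : pairSign i j * pairSign i j = 1 := by
  rcases lt_or_gt_of_ne h with h | h
  · simp [pairSign, h]
  · simp [pairSign, h, h.not_gt]

theorem wedgeSign_eq_zero {u v : Finset (Fin n)} {i : Fin n} (hu : i ∈ u) (hv : i ∈ v) :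
    wedgeSign u v = 0 :=
  Finset.prod_eq_zero hu (Finset.prod_eq_zero hv (pairSign_self i))

theorem wedgeSign_union_left {u v w : Finset (Fin n)} (h : Disjoint u v) :
    wedgeSign (u ∪ v) w = wedgeSign u w * wedgeSign v w := Finset.prod_union h

theorem wedgeSign_union_right {u v w : Finset (Fin n)} (h : Disjoint v w) :
    wedgeSign u (v ∪ w) = wedgeSign u v * wedgeSign u w := by
  simp only [wedgeSign, Finset.prod_union h, Finset.prod_mul_distrib]

theorem wedgeSign_swap (u v : Finset (Fin n)) :
    wedgeSign u v = (-1) ^ (#u * #v) * wedgeSign v u := by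
  have h : ∀ j, (∏ i ∈ u, pairSign i j) = (-1) ^ #u * ∏ i ∈ u, pairSign j i := fun j => by
    rw [← Finset.prod_const, ← Finset.prod_mul_distrib]
    exact Finset.prod_congr rfl fun i _ => by rw [pairSign_swap]; ring
  unfold wedgeSign
  rw [Finset.prod_comm]
  simp only [h, Finset.prod_mul_distrib, Finset.prod_const, ← pow_mul]

theorem wedgeSign_sq {k : Fin n} {u : Finset (Fin n)} (h : k ∉ u) :
    wedgeSign {k} u * wedgeSign {k} u = 1 := by
  simp only [wedgeSign, Finset.prod_singleton, ← Finset.prod_mul_distrib]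
  exact Finset.prod_eq_one fun j hj => pairSign_sq (by rintro rfl; exact h hj)

theorem wedgeSign_assoc (u v w : Finset (Fin n)) :
    wedgeSign u v * wedgeSign (u ∪ v) w = wedgeSign v w * wedgeSign u (v ∪ w) := by
  by_cases h : Disjoint u v
  · by_cases h' : Disjoint v w
    · rw [wedgeSign_union_left h, wedgeSign_union_right h']; ring
    · obtain ⟨i, hi, hi'⟩ := Finset.not_disjoint_iff.1 h'
      rw [wedgeSign_eq_zero hi hi', wedgeSign_eq_zero (Finset.mem_union_right u hi) hi']; ring
  · obtain ⟨i, hi, hi'⟩ := Finset.not_disjoint_iff.1 h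
    rw [wedgeSign_eq_zero hi hi', wedgeSign_eq_zero hi (Finset.mem_union_left w hi')]; ring

theorem diffSign (k : Fin n) (u : Finset (Fin n)) :
    ((-1) ^ #{j ∈ u | j < k} : ℤ) = wedgeSign {k} (u.erase k) := by
  have h : ({j ∈ u | j < k} : Finset (Fin n)) = {j ∈ u.erase k | j < k} := by
    ext j
    simp only [Finset.mem_filter, Finset.mem_erase]
    exact ⟨fun h => ⟨⟨h.2.ne, h.1⟩, h.2⟩, fun h => ⟨h.1.2, h.2⟩⟩
  rw [h, ← Finset.prod_const, Finset.prod_filter, wedgeSign, Finset.prod_singleton]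
  refine Finset.prod_congr rfl fun j hj => ?_
  rcases lt_or_gt_of_ne (Finset.ne_of_mem_erase hj) with h | h
  · simp [pairSign, h, h.not_gt]
  · simp [pairSign, h, h.not_gt]

theorem choose_assoc (a b c : ℕ) :
    (a + b).choose a * (a + b + c).choose (a + b) =
      (b + c).choose b * (a + (b + c)).choose a := by
  have h := Nat.choose_mul (n := a + b + c) (k := a + b) (s := a) (by omega)
  rw [show a + b + c - a = b + c by omega, show a + b - a = b by omega] at h
  rw [mul_comm, h, mul_comm, add_assoc]

theorem mulCoeff_assoc (a b c : Mono n) :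
    mulCoeff a b * mulCoeff (a.1 + b.1, a.2 ∪ b.2) c =
      mulCoeff b c * mulCoeff a (b.1 + c.1, b.2 ∪ c.2) := by
  have h := wedgeSign_assoc a.2 b.2 c.2
  have h2 : (∏ i, (a.1 i + b.1 i).choose (a.1 i)) *
      (∏ i, (a.1 i + b.1 i + c.1 i).choose (a.1 i + b.1 i)) =
      (∏ i, (b.1 i + c.1 i).choose (b.1 i)) *
      (∏ i, (a.1 i + (b.1 i + c.1 i)).choose (a.1 i)) := by
    rw [← Finset.prod_mul_distrib, ← Finset.prod_mul_distrib]
    exact Finset.prod_congr rfl fun i _ => choose_assoc _ _ _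
  have h3 : ((∏ i, (a.1 i + b.1 i).choose (a.1 i) : ℕ) : ℤ) *
      ((∏ i, (a.1 i + b.1 i + c.1 i).choose (a.1 i + b.1 i) : ℕ) : ℤ) =
      ((∏ i, (b.1 i + c.1 i).choose (b.1 i) : ℕ) : ℤ) *
      ((∏ i, (a.1 i + (b.1 i + c.1 i)).choose (a.1 i) : ℕ) : ℤ) := by exact_mod_cast h2
  simp only [mulCoeff, Pi.add_apply]
  linear_combination (wedgeSign a.2 b.2 * wedgeSign (a.2 ∪ b.2) c.2) * h3 +
    ((∏ i, (b.1 i + c.1 i).choose (b.1 i) : ℕ) : ℤ) *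
      ((∏ i, (a.1 i + (b.1 i + c.1 i)).choose (a.1 i) : ℕ) : ℤ) * h

theorem choose_eq_zero_of_carry {F : Type*} [Field F] (p : ℕ) [Fact p.Prime] [CharP F p]
    {k a b : ℕ} (ha : a < p ^ k) (hb : b < p ^ k) (hab : p ^ k ≤ a + b) :
    (((a + b).choose a : ℕ) : F) = 0 := by
  obtain ⟨c, hc⟩ := Nat.exists_eq_add_of_le hab
  have h : ((1 + Polynomial.X : Polynomial F) ^ (a + b)) =
      (1 + Polynomial.X ^ p ^ k) * (1 + Polynomial.X) ^ c := by
    rw [hc, pow_add, add_pow_char_pow, one_pow]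
  have h2 := congrArg (fun q => q.coeff a) h
  simp only [Polynomial.coeff_one_add_X_pow, add_mul, one_mul, Polynomial.coeff_add,
    Polynomial.coeff_X_pow_mul'] at h2
  rw [h2, if_neg (by omega), Nat.choose_eq_zero_of_lt (by omega)]
  simp

end Combinatorics

section Algebra

variable {F : Type*} [Field F] {n : ℕ}

theorem mul_single (a b : Mono n) (c d : F) :
    mul F n (Finsupp.single a c) (Finsupp.single b d) =
      Finsupp.single (a.1 + b.1, a.2 ∪ b.2) (c * d * ((mulCoeff a b : ℤ) : F)) := by
  simp only [mul, Finsupp.linearCombination_single, LinearMap.smul_apply, Finsupp.smul_single,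
    smul_eq_mul, mul_assoc]

theorem mul_assoc' (f g h : DPS F n) :
    mul F n (mul F n f g) h = mul F n f (mul F n g h) := by
  induction f using Finsupp.induction_linear with
  | zero => simp
  | add f₁ f₂ h₁ h₂ => simp only [map_add, LinearMap.add_apply, h₁, h₂]
  | single a c =>
    induction g using Finsupp.induction_linear with
    | zero => simp
    | add f₁ f₂ h₁ h₂ => simp only [map_add, LinearMap.add_apply, h₁, h₂]
    | single b d =>
      induction h using Finsupp.induction_linear with
      | zero => simp
      | add f₁ f₂ h₁ h₂ => simp only [map_add, h₁, h₂]
      | single e k =>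
        rw [mul_single, mul_single, mul_single, mul_single]
        have := congrArg (Int.cast : ℤ → F) (mulCoeff_assoc a b e)
        push_cast at this
        simp only [add_assoc, Finset.union_assoc]
        congr 1
        linear_combination (c * d * k) * this

theorem mem_parity_induction {e : ℕ} {P : DPS F n → Prop} {f : DPS F n}
    (hf : f ∈ parityPart F n e) (h0 : P 0) (hadd : ∀ f g, P f → P g → P (f + g))
    (hs : ∀ (a : Mono n) (c : F), #a.2 ≡ e [MOD 2] → P (Finsupp.single a c)) : P f := by
  rw [← Finsupp.sum_single f]
  refine Finset.sum_induction _ P hadd h0 fun a ha => hs a _ ?_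
  exact (Finsupp.mem_supported F f).1 hf (by simpa using ha)

theorem neg_one_pow_congr {a b : ℕ} (h : a ≡ b [MOD 2]) : ((-1 : F)) ^ a = (-1) ^ b := by
  rw [neg_one_pow_eq_pow_mod_two, neg_one_pow_eq_pow_mod_two (n := b)]
  rw [show a % 2 = b % 2 from h]

theorem mul_comm' {e e' : ℕ} {f g : DPS F n} (hf : f ∈ parityPart F n e)
    (hg : g ∈ parityPart F n e') : mul F n f g = (-1 : F) ^ (e * e') • mul F n g f := by
  refine mem_parity_induction
    (P := fun f => mul F n f g = (-1 : F) ^ (e * e') • mul F n g f) hf (by simp) (fun f₁ f₂ h₁ h₂ => ?_) fun a c ha => ?_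
  · simp only [map_add, LinearMap.add_apply, h₁, h₂, smul_add]
  refine mem_parity_induction
    (P := fun g => mul F n (Finsupp.single a c) g =
      (-1 : F) ^ (e * e') • mul F n g (Finsupp.single a c)) hg (by simp) (fun f₁ f₂ h₁ h₂ => ?_) fun b d hb => ?_
  · simp only [map_add, LinearMap.add_apply, h₁, h₂, smul_add]
  rw [mul_single, mul_single, add_comm b.1, Finset.union_comm b.2, Finsupp.smul_single,
    smul_eq_mul, ← neg_one_pow_congr (F := F) (ha.mul hb)]
  congr 1
  have h1 : mulCoeff a b = (-1) ^ (#a.2 * #b.2) * mulCoeff b a := by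
    have : ∀ i, (a.1 i + b.1 i).choose (a.1 i) = (b.1 i + a.1 i).choose (b.1 i) := fun i => by
      rw [add_comm (b.1 i), Nat.choose_symm_add]
    simp only [mulCoeff, this]
    rw [wedgeSign_swap]; ring
  rw [h1]; push_cast; ring

theorem pd_even_single (i : Fin n) (a : Mono n) (c : F) :
    pd F n (Sum.inl i) (Finsupp.single a c) =
      if a.1 i = 0 then 0 else Finsupp.single (a.1 - Pi.single i 1, a.2) c := by
  simp only [pd, Finsupp.linearCombination_single]
  split_ifs <;> simp

theorem pd_odd_single (k : Fin n) (a : Mono n) (c : F) :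
    pd F n (Sum.inr k) (Finsupp.single a c) =
      if k ∈ a.2 then
        Finsupp.single (a.1, a.2.erase k) (c * ((wedgeSign {k} (a.2.erase k) : ℤ) : F)) else 0 := by
  simp only [pd, Finsupp.linearCombination_single, ← diffSign]
  split_ifs <;> simp

theorem pd_even_mul (i : Fin n) (f g : DPS F n) :
    pd F n (Sum.inl i) (mul F n f g) =
      mul F n (pd F n (Sum.inl i) f) g + mul F n f (pd F n (Sum.inl i) g) := by
  induction f using Finsupp.induction_linear with
  | zero => simp
  | add f₁ f₂ h₁ h₂ => simp only [map_add, LinearMap.add_apply, h₁, h₂]; abel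
  | single a c =>
    induction g using Finsupp.induction_linear with
    | zero => simp
    | add f₁ f₂ h₁ h₂ => simp only [map_add, h₁, h₂]; abel
    | single b d =>
      rw [mul_single, pd_even_single, pd_even_single, pd_even_single]
      have key : ∀ (x y : Fin n → ℕ), (∏ j, (x j + y j).choose (x j)) =
          (x i + y i).choose (x i) * ∏ j ∈ univ.erase i, (x j + y j).choose (x j) :=
        fun x y => (Finset.mul_prod_erase univ (fun j => (x j + y j).choose (x j))
          (Finset.mem_univ i)).symm
      have hL : ∀ x y : Fin n → ℕ, (∏ j ∈ univ.erase i,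
          ((x - Pi.single i 1 : Fin n → ℕ) j + y j).choose ((x - Pi.single i 1 : Fin n → ℕ) j)) =
          ∏ j ∈ univ.erase i, (x j + y j).choose (x j) := fun x y =>
        Finset.prod_congr rfl fun j hj => by
          simp [Finset.ne_of_mem_erase hj]
      have hR : ∀ x y : Fin n → ℕ, (∏ j ∈ univ.erase i,
          (x j + (y - Pi.single i 1 : Fin n → ℕ) j).choose (x j)) =
          ∏ j ∈ univ.erase i, (x j + y j).choose (x j) := fun x y =>
        Finset.prod_congr rfl fun j hj => by
          simp [Finset.ne_of_mem_erase hj]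
      have eL : a.1 i ≠ 0 → a.1 - Pi.single i 1 + b.1 = a.1 + b.1 - Pi.single i 1 := fun h => by
        funext j
        rcases eq_or_ne j i with rfl | hj
        · simp; omega
        · simp [hj]
      have eR : b.1 i ≠ 0 → a.1 + (b.1 - Pi.single i 1) = a.1 + b.1 - Pi.single i 1 := fun h => by
        funext j
        rcases eq_or_ne j i with rfl | hj
        · simp; omega
        · simp [hj]
      rcases Nat.eq_zero_or_pos (a.1 i) with ha | ha <;>
        rcases Nat.eq_zero_or_pos (b.1 i) with hb | hb
      · simp [ha, hb]
      · simp only [Pi.add_apply, ha, hb.ne', if_true, if_false, zero_add, map_zero,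
          LinearMap.zero_apply, mul_single, eR hb.ne', mulCoeff, key, hR]
        congr 1
        simp
      · simp only [Pi.add_apply, ha.ne', hb, if_true, if_false, add_zero, map_zero,
          mul_single, eL ha.ne', mulCoeff, key, hL]
        congr 1
        simp
      · have : a.1 i + b.1 i ≠ 0 := by omega
        simp only [Pi.add_apply, ha.ne', hb.ne', this, if_false, mul_single, eL ha.ne',
          eR hb.ne', mulCoeff, key, hL, hR, ← Finsupp.single_add]
        congr 1
        obtain ⟨x, hx⟩ := Nat.exists_eq_succ_of_ne_zero ha.ne'
        obtain ⟨y, hy⟩ := Nat.exists_eq_succ_of_ne_zero hb.ne'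
        have hp : (a.1 i + b.1 i).choose (a.1 i) =
            ((a.1 - Pi.single i 1 : Fin n → ℕ) i + b.1 i).choose
              ((a.1 - Pi.single i 1 : Fin n → ℕ) i) +
            (a.1 i + (b.1 - Pi.single i 1 : Fin n → ℕ) i).choose (a.1 i) := by
          simp only [Pi.sub_apply, Pi.single_eq_same, hx, hy, Nat.succ_eq_add_one,
            Nat.add_sub_cancel]
          rw [show x + 1 + (y + 1) = (x + y + 1) + 1 by ring, Nat.choose_succ_succ]
          congr 2
          ring
        rw [hp]; push_cast; ring

theorem oddLeibniz (k : Fin n) (u v : Finset (Fin n)) :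
    (if k ∈ u ∪ v then
      (Finsupp.single ((u ∪ v).erase k) (wedgeSign u v * wedgeSign {k} ((u ∪ v).erase k)) :
        Finset (Fin n) →₀ ℤ) else 0) =
    (if k ∈ u then Finsupp.single (u.erase k ∪ v)
      (wedgeSign {k} (u.erase k) * wedgeSign (u.erase k) v) else 0) +
    (if k ∈ v then Finsupp.single (u ∪ v.erase k)
      ((-1) ^ #u * (wedgeSign {k} (v.erase k) * wedgeSign u (v.erase k))) else 0) := by
  have hins : ∀ {w : Finset (Fin n)}, k ∈ w → w = {k} ∪ w.erase k := fun h => by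
    rw [← Finset.insert_eq, Finset.insert_erase h]
  have hd : ∀ w : Finset (Fin n), Disjoint {k} (w.erase k) := fun w => by simp
  have hk : ∀ w : Finset (Fin n), k ∉ w.erase k := fun w => by simp
  by_cases hu : k ∈ u <;> by_cases hv : k ∈ v
  · obtain ⟨u', hu', rfl⟩ : ∃ u', k ∉ u' ∧ u = {k} ∪ u' := ⟨_, hk u, hins hu⟩
    obtain ⟨v', hv', rfl⟩ : ∃ v', k ∉ v' ∧ v = {k} ∪ v' := ⟨_, hk v, hins hv⟩
    have du : Disjoint {k} u' := by simpa using hu'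
    have dv : Disjoint {k} v' := by simpa using hv'
    have e1 : ({k} ∪ u').erase k = u' := by rw [← Finset.insert_eq, Finset.erase_insert hu']
    have e2 : ({k} ∪ v').erase k = v' := by rw [← Finset.insert_eq, Finset.erase_insert hv']
    have e3 : u' ∪ ({k} ∪ v') = {k} ∪ u' ∪ v' := by
      rw [← Finset.union_assoc, Finset.union_comm u']
    have e4 : #({k} ∪ u') = #u' + 1 := by rw [← Finset.insert_eq, Finset.card_insert_of_notMem hu']
    rw [if_pos hu, if_pos hv, if_pos (Finset.mem_union_left _ hu), wedgeSign_eq_zero hu hv,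
      e1, e2, e3, e4, ← Finsupp.single_add, wedgeSign_union_left du, wedgeSign_union_right dv,
      wedgeSign_swap u' {k}]
    have h1 := wedgeSign_sq hu'
    have h2 := wedgeSign_sq hv'
    simp only [zero_mul, Finsupp.single_zero, Finset.card_singleton, mul_one]
    rw [eq_comm, Finsupp.single_eq_zero, pow_succ]
    linear_combination ((-1) ^ #u' * wedgeSign u' v') * (h1 - h2)
  · obtain ⟨u', hu', rfl⟩ : ∃ u', k ∉ u' ∧ u = {k} ∪ u' := ⟨_, hk u, hins hu⟩
    have du : Disjoint {k} u' := by simpa using hu'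
    have e1 : ({k} ∪ u').erase k = u' := by rw [← Finset.insert_eq, Finset.erase_insert hu']
    have e2 : ({k} ∪ u' ∪ v).erase k = u' ∪ v := by
      rw [Finset.union_assoc, ← Finset.insert_eq, Finset.erase_insert (by simp [hu', hv])]
    rw [if_pos hu, if_neg hv, if_pos (Finset.mem_union_left _ hu), e1, e2, add_zero]
    congr 1
    by_cases h : Disjoint u' v
    · rw [wedgeSign_union_left du, wedgeSign_union_right h]
      linear_combination (wedgeSign {k} u' * wedgeSign u' v) * wedgeSign_sq hv
    · obtain ⟨i, hi, hi'⟩ := Finset.not_disjoint_iff.1 h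
      rw [wedgeSign_eq_zero hi hi', wedgeSign_eq_zero (Finset.mem_union_right _ hi) hi']; ring
  · obtain ⟨v', hv', rfl⟩ : ∃ v', k ∉ v' ∧ v = {k} ∪ v' := ⟨_, hk v, hins hv⟩
    have dv : Disjoint {k} v' := by simpa using hv'
    have e1 : ({k} ∪ v').erase k = v' := by rw [← Finset.insert_eq, Finset.erase_insert hv']
    have e2 : (u ∪ ({k} ∪ v')).erase k = u ∪ v' := by
      rw [Finset.union_left_comm, ← Finset.insert_eq, Finset.erase_insert (by simp [hu, hv'])]
    rw [if_neg hu, if_pos hv, if_pos (Finset.mem_union_right _ hv), e1, e2, zero_add]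
    congr 1
    by_cases h : Disjoint u v'
    · rw [wedgeSign_union_right dv, wedgeSign_union_right h, wedgeSign_swap u {k}]
      simp only [Finset.card_singleton, mul_one]
      linear_combination ((-1) ^ #u * wedgeSign {k} v' * wedgeSign u v') * wedgeSign_sq hu
    · obtain ⟨i, hi, hi'⟩ := Finset.not_disjoint_iff.1 h
      rw [wedgeSign_eq_zero hi hi', wedgeSign_eq_zero hi (Finset.mem_union_right _ hi')]; ring
  · rw [if_neg hu, if_neg hv, if_neg (by simp [hu, hv]), add_zero]

theorem pd_odd_mul_single (k : Fin n) (a b : Mono n) (c d : F) :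
    pd F n (Sum.inr k) (mul F n (Finsupp.single a c) (Finsupp.single b d)) =
      mul F n (pd F n (Sum.inr k) (Finsupp.single a c)) (Finsupp.single b d) +
      (-1 : F) ^ #a.2 •
        mul F n (Finsupp.single a c) (pd F n (Sum.inr k) (Finsupp.single b d)) := by
  let q : F := c * d * ((∏ i, (a.1 i + b.1 i).choose (a.1 i) : ℕ) : F)
  let T : (Finset (Fin n) →₀ ℤ) →+ DPS F n := Finsupp.liftAddHom fun w =>
    (Finsupp.singleAddHom (a.1 + b.1, w)).comp
      ((AddMonoidHom.mulLeft q).comp (Int.castAddHom F))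
  have hT : ∀ w m, T (Finsupp.single w m) = Finsupp.single (a.1 + b.1, w) (q * (m : F)) :=
    fun w m => by simp [T]
  have h := congrArg T (oddLeibniz k a.2 b.2)
  rw [map_add] at h
  rw [mul_single, pd_odd_single, pd_odd_single, pd_odd_single]
  simp only [apply_ite T, hT, map_zero] at h
  convert h using 1
  · refine if_congr Iff.rfl ?_ rfl
    congr 1
    simp only [q, mulCoeff]; push_cast; ring
  · congr 1
    · by_cases hk : k ∈ a.2
      · simp only [if_pos hk, mul_single]
        congr 1
        simp only [q, mulCoeff]; push_cast; ring
      · simp [hk]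
    · by_cases hk : k ∈ b.2
      · simp only [if_pos hk, mul_single, Finsupp.smul_single, smul_eq_mul]
        congr 1
        simp only [q, mulCoeff]; push_cast; ring
      · simp [hk]

theorem pd_mul (r : Ind n) {e : ℕ} {f : DPS F n} (hf : f ∈ parityPart F n e) (g : DPS F n) :
    pd F n r (mul F n f g) =
      mul F n (pd F n r f) g + (-1 : F) ^ (par r * e) • mul F n f (pd F n r g) := by
  rcases r with i | k
  · simp [par, pd_even_mul]
  · refine mem_parity_induction
      (P := fun f => pd F n (Sum.inr k) (mul F n f g) = mul F n (pd F n (Sum.inr k) f) g +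
        (-1 : F) ^ (par (Sum.inr k : Ind n) * e) • mul F n f (pd F n (Sum.inr k) g)) hf (by simp)
      (fun f₁ f₂ h₁ h₂ => ?_) fun a c ha => ?_
    · simp only [map_add, LinearMap.add_apply, h₁, h₂, smul_add]; abel
    · induction g using Finsupp.induction_linear with
      | zero => simp
      | add f₁ f₂ h₁ h₂ => simp only [map_add, h₁, h₂, smul_add]; abel
      | single b d =>
        rw [pd_odd_mul_single, neg_one_pow_congr (F := F) ha]
        simp only [par, one_mul]

theorem pd_comm (r s : Ind n) (f : DPS F n) :
    pd F n r (pd F n s f) = (-1 : F) ^ (par r * par s) • pd F n s (pd F n r f) := by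
  induction f using Finsupp.induction_linear with
  | zero => simp
  | add f₁ f₂ h₁ h₂ => simp only [map_add, h₁, h₂, smul_add]
  | single a c =>
    rcases r with i | k <;> rcases s with j | l
    · rcases eq_or_ne i j with rfl | hij
      · simp [par]
      · simp only [pd_even_single, par, apply_ite (pd F n (Sum.inl i)),
          apply_ite (pd F n (Sum.inl j)), map_zero, Pi.sub_apply, Pi.single_apply, hij, hij.symm,
          if_false, Nat.sub_zero, tsub_right_comm]
        split_ifs <;> simp
    · simp only [pd_even_single, pd_odd_single, par, apply_ite (pd F n (Sum.inl i)),
        apply_ite (pd F n (Sum.inr l)), map_zero]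
      split_ifs <;> simp
    · simp only [pd_even_single, pd_odd_single, par, apply_ite (pd F n (Sum.inl j)),
        apply_ite (pd F n (Sum.inr k)), map_zero]
      split_ifs <;> simp
    · rcases eq_or_ne k l with rfl | hkl
      · have : pd F n (Sum.inr k) (pd F n (Sum.inr k) (Finsupp.single a c)) = 0 := by
          rw [pd_odd_single]
          split_ifs
          · rw [pd_odd_single]; simp
          · simp
        simp [this]
      · have hs : ∀ {x y : Fin n} {u : Finset (Fin n)}, x ≠ y → y ∈ u →
            wedgeSign {x} (u.erase x) = pairSign x y * wedgeSign {x} ((u.erase x).erase y) :=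
          fun {x y u} hxy hy => by
            simp only [wedgeSign, Finset.prod_singleton]
            exact (Finset.mul_prod_erase _ _ (Finset.mem_erase.2 ⟨hxy.symm, hy⟩)).symm
        by_cases hk : k ∈ a.2 <;> by_cases hl : l ∈ a.2
        · have hk' : k ∈ a.2.erase l := Finset.mem_erase.2 ⟨hkl, hk⟩
          have hl' : l ∈ a.2.erase k := Finset.mem_erase.2 ⟨hkl.symm, hl⟩
          simp only [pd_odd_single, if_pos hk, if_pos hl, if_pos hk', if_pos hl',
            Finsupp.smul_single, smul_eq_mul, Finset.erase_right_comm (a := l) (b := k)]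
          congr 1
          rw [hs hkl hl, hs hkl.symm hk, Finset.erase_right_comm (a := l) (b := k),
            pairSign_swap l k]
          simp only [par]
          push_cast; ring
        · simp only [pd_odd_single, if_pos hk, Finset.mem_erase, hl, and_false,
            if_false, map_zero, smul_zero]
        · simp only [pd_odd_single, if_pos hl, Finset.mem_erase, hk, and_false,
            if_false, map_zero, smul_zero]
        · simp only [pd_odd_single, if_neg hl, if_neg hk, map_zero, smul_zero]

theorem parityPart_congr {e e' : ℕ} (h : e ≡ e' [MOD 2]) {f : DPS F n}
    (hf : f ∈ parityPart F n e) : f ∈ parityPart F n e' :=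
  Finsupp.supported_mono (fun _ ha => Nat.ModEq.trans ha h) hf

theorem single_mem_parityPart {e : ℕ} {a : Mono n} (c : F) (h : #a.2 ≡ e [MOD 2]) :
    Finsupp.single a c ∈ parityPart F n e := Finsupp.single_mem_supported F c h

theorem mul_mem_parityPart {e e' : ℕ} {f g : DPS F n} (hf : f ∈ parityPart F n e)
    (hg : g ∈ parityPart F n e') : mul F n f g ∈ parityPart F n (e + e') := by
  refine mem_parity_induction (P := fun f => mul F n f g ∈ parityPart F n (e + e')) hf (by simp)
    (fun f₁ f₂ h₁ h₂ => ?_) fun a c ha => ?_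
  · simpa only [map_add, LinearMap.add_apply] using add_mem h₁ h₂
  refine mem_parity_induction
    (P := fun g => mul F n (Finsupp.single a c) g ∈ parityPart F n (e + e')) hg (by simp)
    (fun f₁ f₂ h₁ h₂ => ?_) fun b d hb => ?_
  · simpa only [map_add] using add_mem h₁ h₂
  rw [mul_single]
  by_cases h : Disjoint a.2 b.2
  · refine single_mem_parityPart _ ?_
    rw [Finset.card_union_of_disjoint h]
    exact ha.add hb
  · obtain ⟨i, hi, hi'⟩ := Finset.not_disjoint_iff.1 h
    simp [mulCoeff, wedgeSign_eq_zero hi hi']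

theorem pd_mem_parityPart (r : Ind n) {e : ℕ} {f : DPS F n} (hf : f ∈ parityPart F n e) :
    pd F n r f ∈ parityPart F n (e + par r) := by
  refine mem_parity_induction (P := fun f => pd F n r f ∈ parityPart F n (e + par r)) hf (by simp)
    (fun f₁ f₂ h₁ h₂ => ?_) fun a c ha => ?_
  · simpa only [map_add] using add_mem h₁ h₂
  rcases r with i | k
  · rw [pd_even_single]
    split_ifs
    · simp
    · exact single_mem_parityPart _ ha
  · rw [pd_odd_single]
    split_ifs with h
    · refine single_mem_parityPart _ ?_
      have h1 : #(a.2.erase k) + 1 = #a.2 := Finset.card_erase_add_one h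
      have h2 : #a.2 % 2 = e % 2 := ha
      change #(a.2.erase k) % 2 = (e + 1) % 2
      omega
    · simp

theorem mem_trunc_induction {p : ℕ} {t : Fin n → ℕ} {P : DPS F n → Prop} {f : DPS F n}
    (hf : f ∈ trunc F p t) (h0 : P 0) (hadd : ∀ f g, P f → P g → P (f + g))
    (hs : ∀ (a : Mono n) (c : F), (∀ i, a.1 i ≤ p ^ t i - 1) → P (Finsupp.single a c)) : P f := by
  rw [← Finsupp.sum_single f]
  refine Finset.sum_induction _ P hadd h0 fun a ha => hs a _ ?_
  exact (Finsupp.mem_supported F f).1 hf (by simpa using ha)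

theorem mul_mem_trunc {p : ℕ} [Fact p.Prime] [CharP F p] {t : Fin n → ℕ} {f g : DPS F n}
    (hf : f ∈ trunc F p t) (hg : g ∈ trunc F p t) : mul F n f g ∈ trunc F p t := by
  refine mem_trunc_induction (P := fun f => mul F n f g ∈ trunc F p t) hf (by simp)
    (fun f₁ f₂ h₁ h₂ => ?_) fun a c ha => ?_
  · simpa only [map_add, LinearMap.add_apply] using add_mem h₁ h₂
  refine mem_trunc_induction
    (P := fun g => mul F n (Finsupp.single a c) g ∈ trunc F p t) hg (by simp)
    (fun f₁ f₂ h₁ h₂ => ?_) fun b d hb => ?_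
  · simpa only [map_add] using add_mem h₁ h₂
  rw [mul_single]
  by_cases h : ∀ i, a.1 i + b.1 i ≤ p ^ t i - 1
  · exact Finsupp.single_mem_supported F _ h
  · push Not at h
    obtain ⟨i, hi⟩ := h
    have hp : 0 < p ^ t i := pow_pos (Fact.out : p.Prime).pos _
    have h1 := ha i
    have h2 := hb i
    have h0 : (((a.1 i + b.1 i).choose (a.1 i) : ℕ) : F) = 0 :=
      choose_eq_zero_of_carry p (k := t i) (by omega) (by omega) (by omega)
    have : ((mulCoeff a b : ℤ) : F) = 0 := by
      simp only [mulCoeff]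
      push_cast
      rw [Finset.prod_eq_zero (Finset.mem_univ i) h0, zero_mul]
    simp [this]

theorem pd_mem_trunc {p : ℕ} {t : Fin n → ℕ} (r : Ind n) {f : DPS F n}
    (hf : f ∈ trunc F p t) : pd F n r f ∈ trunc F p t := by
  refine mem_trunc_induction (P := fun f => pd F n r f ∈ trunc F p t) hf (by simp)
    (fun f₁ f₂ h₁ h₂ => ?_) fun a c ha => ?_
  · simpa only [map_add] using add_mem h₁ h₂
  rcases r with i | k
  · rw [pd_even_single]
    split_ifs
    · simp
    · exact Finsupp.single_mem_supported F _ fun j => (Nat.sub_le _ _).trans (ha j)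
  · rw [pd_odd_single]
    split_ifs with h
    · exact Finsupp.single_mem_supported F _ ha
    · simp

theorem vf_apply (f : Ind n → DPS F n) (a : DPS F n) :
    vf F n f a = ∑ r, mul F n (f r) (pd F n r a) := by
  simp [vf]

theorem vf_mem_trunc {p : ℕ} [Fact p.Prime] [CharP F p] {t : Fin n → ℕ} {f : Ind n → DPS F n}
    (hf : ∀ r, f r ∈ trunc F p t) {a : DPS F n} (ha : a ∈ trunc F p t) :
    vf F n f a ∈ trunc F p t := by
  rw [vf_apply]
  exact Submodule.sum_mem _ fun r _ => mul_mem_trunc (hf r) (pd_mem_trunc r ha)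

theorem vf_mem_parityPart {f : Ind n → DPS F n} (hf : ∀ r, f r ∈ parityPart F n (par r)) {e : ℕ}
    {a : DPS F n} (ha : a ∈ parityPart F n e) : vf F n f a ∈ parityPart F n e := by
  rw [vf_apply]
  refine Submodule.sum_mem _ fun r _ => parityPart_congr ?_
    (mul_mem_parityPart (hf r) (pd_mem_parityPart r ha))
  change (par r + (e + par r)) % 2 = e % 2
  omega

theorem vf_mul {f : Ind n → DPS F n} (hf : ∀ r, f r ∈ parityPart F n (par r)) {e : ℕ}
    {a : DPS F n} (ha : a ∈ parityPart F n e) (b : DPS F n) :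
    vf F n f (mul F n a b) = mul F n (vf F n f a) b + mul F n a (vf F n f b) := by
  simp only [vf_apply, map_sum, LinearMap.sum_apply]
  rw [← Finset.sum_add_distrib]
  refine Finset.sum_congr rfl fun r _ => ?_
  rw [pd_mul r ha, map_add, map_smul, mul_assoc', ← mul_assoc' (f r) a, mul_comm' (hf r) ha,
    map_smul, LinearMap.smul_apply, smul_smul, ← pow_add, mul_assoc']
  congr 1
  rw [← two_mul, pow_mul]
  simp

theorem vf_lie {f g : Ind n → DPS F n} (hf : ∀ r, f r ∈ parityPart F n (par r))
    (hg : ∀ r, g r ∈ parityPart F n (par r)) :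
    vf F n f * vf F n g - vf F n g * vf F n f = vf F n fun s => vf F n f (g s) - vf F n g (f s) := by
  refine LinearMap.ext fun a => ?_
  have key : ∀ {f g : Ind n → DPS F n}, (∀ r, f r ∈ parityPart F n (par r)) →
      (∀ r, g r ∈ parityPart F n (par r)) → vf F n f (vf F n g a) =
        ∑ s, mul F n (vf F n f (g s)) (pd F n s a) +
        ∑ s, ∑ r, mul F n (mul F n (g s) (f r)) (pd F n r (pd F n s a)) := by
    intro f g _ hg
    rw [vf_apply g a, map_sum, ← Finset.sum_add_distrib]
    refine Finset.sum_congr rfl fun s _ => ?_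
    rw [vf_mul (by assumption) (hg s), vf_apply f (pd F n s a), map_sum]
    simp only [mul_assoc']
  rw [LinearMap.sub_apply, Module.End.mul_apply,
    Module.End.mul_apply, key hf hg, key hg hf, vf_apply]
  have hs : ∑ s, ∑ r, mul F n (mul F n (f s) (g r)) (pd F n r (pd F n s a)) =
      ∑ s, ∑ r, mul F n (mul F n (g s) (f r)) (pd F n r (pd F n s a)) := by
    rw [Finset.sum_comm]
    refine Finset.sum_congr rfl fun s _ => Finset.sum_congr rfl fun r _ => ?_
    rw [mul_comm' (hf r) (hg s), pd_comm s r, map_smul, map_smul, LinearMap.smul_apply, smul_smul,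
      ← pow_add, mul_comm (par s), ← two_mul, pow_mul]
    simp
  simp only [hs, add_sub_add_right_eq_sub, map_sub, LinearMap.sub_apply, Finset.sum_sub_distrib]

theorem par_swap (r : Ind n) : par r + par r.swap = 1 := by
  rcases r with i | i <;> rfl

/-- The coefficient of `∂_r` in `T_H(a)`. -/
def hc (a : DPS F n) (r : Ind n) : DPS F n := pd F n r.swap (twist F n r.swap a)

theorem TH_eq (a : DPS F n) : TH F n a = vf F n (hc a) := by
  simp only [TH, vf, hc, LinearMap.coe_mk, AddHom.coe_mk]
  refine Fintype.sum_equiv (Equiv.sumComm _ _) _ _ fun i => ?_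
  simp

theorem twist_eq {e : ℕ} {a : DPS F n} (ha : a ∈ parityPart F n e) (r : Ind n) :
    twist F n r a = (-1 : F) ^ (par r * e) • a := by
  refine mem_parity_induction (P := fun a => twist F n r a = (-1 : F) ^ (par r * e) • a) ha
    (by simp) (fun f₁ f₂ h₁ h₂ => by rw [map_add, h₁, h₂, smul_add]) fun a c h => ?_
  rw [← neg_one_pow_congr (F := F) (h.mul_left (par r))]
  simp only [twist, Finsupp.linearCombination_single, Finsupp.smul_single, smul_eq_mul, mul_comm]

theorem hc_eq {e : ℕ} {a : DPS F n} (ha : a ∈ parityPart F n e) (r : Ind n) :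
    hc a r = (-1 : F) ^ (par r.swap * e) • pd F n r.swap a := by
  rw [hc, twist_eq ha, map_smul]

theorem twist_mem_trunc {p : ℕ} {t : Fin n → ℕ} (r : Ind n) {f : DPS F n}
    (hf : f ∈ trunc F p t) : twist F n r f ∈ trunc F p t := by
  refine mem_trunc_induction (P := fun f => twist F n r f ∈ trunc F p t) hf (by simp)
    (fun f₁ f₂ h₁ h₂ => ?_) fun a c ha => ?_
  · simpa only [map_add] using add_mem h₁ h₂
  · simp only [twist, Finsupp.linearCombination_single]
    exact Submodule.smul_mem _ _ (Finsupp.single_mem_supported F _ ha)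

theorem hc_mem_trunc {p : ℕ} {t : Fin n → ℕ} {a : DPS F n} (ha : a ∈ trunc F p t) (r : Ind n) :
    hc a r ∈ trunc F p t := pd_mem_trunc _ (twist_mem_trunc _ ha)

theorem hc_mem_parityPart {e : ℕ} {a : DPS F n} (ha : a ∈ parityPart F n e) (r : Ind n) :
    hc a r ∈ parityPart F n (e + par r.swap) := by
  rw [hc_eq ha]
  exact Submodule.smul_mem _ _ (pd_mem_parityPart _ ha)

theorem hc_mem_parityPart_one {a : DPS F n} (ha : a ∈ parityPart F n 1) (r : Ind n) :
    hc a r ∈ parityPart F n (par r) := by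
  refine parityPart_congr ?_ (hc_mem_parityPart ha r)
  have := par_swap r
  change (1 + par r.swap) % 2 = par r % 2
  omega

theorem TH_apply_odd {a : DPS F n} (ha : a ∈ parityPart F n 1) (c : DPS F n) :
    TH F n a c = ∑ j : Ind n, (-1 : F) ^ par j • mul F n (pd F n j a) (pd F n j.swap c) := by
  simp only [TH, LinearMap.coe_mk, AddHom.coe_mk, LinearMap.sum_apply, LinearMap.comp_apply,
    twist_eq ha, mul_one, map_smul, LinearMap.smul_apply]

theorem TH_lie {a b : DPS F n} (ha : a ∈ parityPart F n 1) (hb : b ∈ parityPart F n 1) :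
    TH F n a * TH F n b - TH F n b * TH F n a = TH F n (TH F n a b) := by
  have hab : TH F n a b ∈ parityPart F n 1 := by
    rw [TH_eq]; exact vf_mem_parityPart (hc_mem_parityPart_one ha) hb
  have key : ∀ i : Ind n, pd F n i (TH F n a b) =
      TH F n a (pd F n i b) - TH F n b (pd F n i a) := by
    intro i
    have h1 : pd F n i (TH F n a b) =
        ∑ j : Ind n, ((-1 : F) ^ par j • mul F n (pd F n i (pd F n j a)) (pd F n j.swap b) +
          (-1 : F) ^ par j • mul F n (pd F n j a) (pd F n j.swap (pd F n i b))) := by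
      rw [TH_apply_odd ha, map_sum]
      refine Finset.sum_congr rfl fun j _ => ?_
      have hj := par_swap j
      have hs : (-1 : F) ^ (par i * (1 + par j) + par i * par j.swap) = 1 := by
        rw [← mul_add, show 1 + par j + par j.swap = 2 by omega, mul_comm, pow_mul]
        simp
      rw [map_smul, pd_mul i (pd_mem_parityPart j ha), pd_comm i j.swap, smul_add, map_smul,
        smul_smul ((-1) ^ (par i * (1 + par j))), ← pow_add, hs, one_smul]
    have h2 : TH F n b (pd F n i a) =
        -∑ j : Ind n, (-1 : F) ^ par j • mul F n (pd F n i (pd F n j a)) (pd F n j.swap b) := by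
      rw [TH_apply_odd hb, ← Finset.sum_neg_distrib]
      refine Fintype.sum_equiv (Equiv.sumComm _ _) _ _ fun j => ?_
      have hj := par_swap j
      simp only [Equiv.sumComm_apply, Sum.swap_swap]
      rw [mul_comm' (pd_mem_parityPart j hb) (pd_mem_parityPart _ (pd_mem_parityPart i ha)),
        pd_comm j.swap i, map_smul, LinearMap.smul_apply, smul_smul, smul_smul, ← pow_add,
        ← pow_add, ← neg_smul]
      congr 1
      rw [show -(-1 : F) ^ par j.swap = (-1) ^ (par j.swap + 1) by rw [pow_succ]; ring]
      refine neg_one_pow_congr ?_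
      rcases i with i | i <;> rcases j with j | j <;> simp [par, Nat.ModEq]
    rw [h1, h2, TH_apply_odd ha, Finset.sum_add_distrib]
    abel
  have hfin : (fun s => vf F n (hc a) (hc b s) - vf F n (hc b) (hc a s)) =
      hc (TH F n a b) := by
    funext s
    rw [hc_eq hab, key, hc_eq ha, hc_eq hb, map_smul, map_smul, ← TH_eq, ← TH_eq, smul_sub]
  rw [TH_eq (TH F n a b), ← hfin, ← vf_lie (hc_mem_parityPart_one ha) (hc_mem_parityPart_one hb),
    ← TH_eq, ← TH_eq]

/-- The variable `x_r`, `r ∈ Y`. -/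
def var : Ind n → DPS F n
  | Sum.inl i => Finsupp.single (Pi.single i 1, ∅) 1
  | Sum.inr k => Finsupp.single (0, {k}) 1

theorem pd_var (r s : Ind n) :
    pd F n r (var s) = if r = s then Finsupp.single (0, ∅) 1 else 0 := by
  rcases r with i | k <;> rcases s with j | l
  · simp only [var, pd_even_single, Sum.inl.injEq]
    rcases eq_or_ne i j with rfl | h
    · simp
    · simp [h]
  · simp [var, pd_even_single]
  · simp [var, pd_odd_single]
  · simp only [var, pd_odd_single, Sum.inr.injEq, Finset.mem_singleton]
    split_ifs with h
    · subst h; simp [wedgeSign]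
    · rfl

theorem mul_one' (f : DPS F n) : mul F n f (Finsupp.single (0, ∅) 1) = f := by
  induction f using Finsupp.induction_linear with
  | zero => simp
  | add f₁ f₂ h₁ h₂ => rw [map_add, LinearMap.add_apply, h₁, h₂]
  | single a c => rw [mul_single]; simp [mulCoeff, wedgeSign]

theorem vf_var (f : Ind n → DPS F n) (s : Ind n) : vf F n f (var s) = f s := by
  rw [vf_apply, Finset.sum_eq_single s]
  · rw [pd_var, if_pos rfl, mul_one']
  · intro r _ h; rw [pd_var, if_neg h, map_zero]
  · simp

theorem vf_injective : Function.Injective (vf F n) := fun f g h => by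
  funext s; rw [← vf_var f, h, vf_var]

theorem exists_parts {p : ℕ} {t : Fin n → ℕ} {a : DPS F n} (ha : a ∈ trunc F p t) :
    ∃ b c, b ∈ trunc F p t ∧ c ∈ trunc F p t ∧ b ∈ parityPart F n 0 ∧ c ∈ parityPart F n 1 ∧
      a = b + c := by
  refine mem_trunc_induction (P := fun a => ∃ b c, b ∈ trunc F p t ∧ c ∈ trunc F p t ∧
    b ∈ parityPart F n 0 ∧ c ∈ parityPart F n 1 ∧ a = b + c) ha
    ⟨0, 0, by simp, by simp, by simp, by simp, by simp⟩ ?_ fun a c h => ?_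
  · rintro _ _ ⟨b, c, h1, h2, h3, h4, rfl⟩ ⟨b', c', h1', h2', h3', h4', rfl⟩
    exact ⟨b + b', c + c', add_mem h1 h1', add_mem h2 h2', add_mem h3 h3', add_mem h4 h4',
      add_add_add_comm _ _ _ _⟩
  · have hm : Finsupp.single a c ∈ trunc F p t := Finsupp.single_mem_supported F _ h
    rcases Nat.mod_two_eq_zero_or_one #a.2 with h0 | h1
    · exact ⟨_, 0, hm, by simp, single_mem_parityPart _ h0, by simp, by simp⟩
    · exact ⟨0, _, by simp, hm, by simp, single_mem_parityPart _ h1, by simp⟩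

theorem parityPart_disjoint {e e' : ℕ} (h : ¬ e ≡ e' [MOD 2]) {f : DPS F n}
    (hf : f ∈ parityPart F n e) (hf' : f ∈ parityPart F n e') : f = 0 := by
  refine Finsupp.support_eq_empty.1 (Finset.eq_empty_of_forall_notMem fun a ha => h ?_)
  have h1 : #a.2 ≡ e [MOD 2] := (Finsupp.mem_supported F f).1 hf (by simpa using ha)
  have h2 : #a.2 ≡ e' [MOD 2] := (Finsupp.mem_supported F f).1 hf' (by simpa using ha)
  exact h1.symm.trans h2

/-- The even elements of `HO(n,n;t)` are the `T_H(a)` with `a` odd. -/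
theorem mem_hoEven_iff {p : ℕ} {t : Fin n → ℕ} (D : Module.End F (DPS F n)) :
    (D ∈ hoSub F p t ∧ D ∈ wittEvenSub F p t) ↔
      ∃ a, a ∈ trunc F p t ∧ a ∈ parityPart F n 1 ∧ TH F n a = D := by
  constructor
  · rintro ⟨⟨a, ha, rfl⟩, ⟨f, hf, hfa⟩⟩
    obtain ⟨b, c, hb, hc', hb0, hc1, rfl⟩ := exists_parts ha
    refine ⟨c, hc', hc1, ?_⟩
    rw [map_add, TH_eq b, TH_eq c, ← map_add] at hfa
    have hfa := sub_eq_iff_eq_add.2 (vf_injective hfa)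
    have h0 : hc b = 0 := by
      funext r
      have h1 : (f - hc c) r ∈ parityPart F n (par r) :=
        sub_mem (hf r trivial).2 (hc_mem_parityPart_one hc1 r)
      rw [hfa] at h1
      refine parityPart_disjoint ?_ h1 (hc_mem_parityPart hb0 r)
      rcases r with r | r <;> simp [par, Nat.ModEq]
    rw [map_add, TH_eq b, h0, map_zero, zero_add]
  · rintro ⟨a, ha, h1, rfl⟩
    refine ⟨⟨a, ha, rfl⟩, ⟨hc a, ?_, (TH_eq a).symm⟩⟩
    exact fun r _ => ⟨hc_mem_trunc ha r, hc_mem_parityPart_one h1 r⟩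

end Algebra

/-! ### The Lie algebras and the derivations -/

section Main

variable (F : Type*) [Field F] (p : ℕ) [Fact p.Prime] [CharP F p] {n : ℕ} (t : Fin n → ℕ)

/-- The Lie algebra structure on the operators on `𝒪(n,n)`, `[D, E] = DE - ED`. -/
instance endLieRing (F : Type*) [Field F] (n : ℕ) : LieRing (Module.End F (DPS F n)) :=
  LieRing.ofAssociativeRing

instance endLieAlgebra (F : Type*) [Field F] (n : ℕ) : LieAlgebra F (Module.End F (DPS F n)) :=
  LieAlgebra.ofAssociativeAlgebra

/-- The Lie algebra `𝒲`, the even part of `W(n,n;t)`, as a Lie algebra of operators on `𝒪(n,n)`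
under the commutator (which is the bracket of even elements of `W(n,n)`). -/
def wittEven : LieSubalgebra F (Module.End F (DPS F n)) where
  __ := wittEvenSub F p t
  lie_mem' := by
    rintro _ _ ⟨f, hf, rfl⟩ ⟨g, hg, rfl⟩
    refine ⟨fun s => vf F n f (g s) - vf F n g (f s), fun s _ => ⟨?_, ?_⟩,
      (vf_lie (fun r => (hf r trivial).2) (fun r => (hg r trivial).2)).symm⟩
    · exact sub_mem (vf_mem_trunc (fun r => (hf r trivial).1) (hg s trivial).1)
        (vf_mem_trunc (fun r => (hg r trivial).1) (hf s trivial).1)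
    · exact sub_mem (vf_mem_parityPart (fun r => (hf r trivial).2) (hg s trivial).2)
        (vf_mem_parityPart (fun r => (hg r trivial).2) (hf s trivial).2)

/-- The Lie algebra `ℋ𝒪`, the even part of `HO(n,n;t)`, as a subalgebra of `𝒲`. -/
def hoEven : LieSubalgebra F (wittEven F p t) where
  __ := (hoSub F p t).comap (wittEven F p t).toSubmodule.subtype
  lie_mem' := by
    rintro ⟨x, hx⟩ ⟨y, hy⟩ hx' hy'
    obtain ⟨a, ha, ha1, rfl⟩ := (mem_hoEven_iff x).1 ⟨hx', hx⟩
    obtain ⟨b, hb, hb1, rfl⟩ := (mem_hoEven_iff y).1 ⟨hy', hy⟩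
    refine ⟨TH F n a b, ?_, (TH_lie ha1 hb1).symm⟩
    rw [TH_eq]
    exact vf_mem_trunc (hc_mem_trunc ha) hb

/-- The component `𝒲_d` of the `ℤ`-grading of `𝒲`. -/
def wittEvenDeg (d : ℤ) : Submodule F (wittEven F p t) :=
  (wittDeg F p t d).comap (wittEven F p t).toSubmodule.subtype

/-- The component `ℋ𝒪_d = ℋ𝒪 ∩ 𝒲_d` of the `ℤ`-grading of `ℋ𝒪`. -/
def hoEvenDeg (d : ℤ) : Submodule F (hoEven F p t) :=
  (wittEvenDeg F p t d).comap (hoEven F p t).toSubmodule.subtype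

/-- `Der_d(ℋ𝒪, 𝒲)`: the derivations `D` from `ℋ𝒪` into the `ℋ𝒪`-module `𝒲` with
`D(ℋ𝒪_i) ⊆ 𝒲_{d+i}` for all `i ∈ ℤ`. -/
def derDeg (d : ℤ) : Submodule F (LieDerivation F (hoEven F p t) (wittEven F p t)) where
  carrier := {D | ∀ i : ℤ, ∀ x ∈ hoEvenDeg F p t i, D x ∈ wittEvenDeg F p t (d + i)}
  zero_mem' := fun _ _ _ => Submodule.zero_mem _
  add_mem' := fun h₁ h₂ i x hx => Submodule.add_mem _ (h₁ i x hx) (h₂ i x hx)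
  smul_mem' := fun c _ h i x hx => Submodule.smul_mem _ c (h i x hx)

/-- The map `E ↦ ad E`, where `ad E : ℋ𝒪 → 𝒲` is the derivation `x ↦ [E, x]`. -/
def adW : wittEven F p t →ₗ[F] LieDerivation F (hoEven F p t) (wittEven F p t) :=
  -LieDerivation.inner F (hoEven F p t) (wittEven F p t)

theorem adW_apply (E : wittEven F p t) (x : hoEven F p t) :
    adW F p t E x = ⁅E, (x : wittEven F p t)⁆ := by
  rw [← lie_skew]
  rfl

end Main

end OddHamiltonian

end
/-!
A derivation `D` of degree `d ≥ 0` is brought to zero by subtracting inner derivations.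

First `D` is made to vanish on the fields `T_H(x_{i'}) = -∂_i`. The `D(∂_i)` satisfy
`∂_i D(∂_j) = ∂_j D(∂_i)`, so in divided powers of unbounded height they are `∂_i G` for some `G`;
`G` stays below height `p^{t_i}` because `D(∂_i)` has no component of top degree in `x_i`. Indeed,
`ad x` acts on linear maps as left minus right multiplication by commuting operators, hence its
`p^{t_i}`-th power vanishes for `x = ∂_i`, which says that `(ad x)^{p^{t_i} - 1} (D x)` centralizes
`ℋ𝒪`; and the centralizer of `ℋ𝒪` in `𝒲` is zero.

Next `D` is made to vanish on the torus spanned by the fields `T_H(x_i x_{i'})`, which acts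
diagonally on monomials. Then `D` preserves torus weights modulo `p`. Inductively on `|α|`, the
coefficients of `D(T_H(x^(α) x^u))` involve no even variables, and comparing weights with degrees
shows that `D = 0` if `d > 0`, while for `d = 0` only the case `|α| ≤ 1` survives. There
`D(T_H(x_i x_{j'})) = q_{ij} x_{j'} ∂_{i'}` with `q_{ij} + q_{jk} = q_{ik}`, which is removed by a
field `∑_j c_j x_{j'} ∂_{j'}`; it is determined up to a multiple of `∑_j x_{j'} ∂_{j'}`, which is
used to kill `D` on one `T_H(x^u)` with `|u| = 3`. The remaining `T_H(x^u)` and `T_H(x_j x^u)` are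
obtained from these by brackets.
-/

noncomputable section

namespace OddHamiltonian

open Finset

section Degree

variable {F : Type*} [Field F] {n : ℕ}

theorem map_mem_of_mem_supported {ι R M : Type*} [Semiring R] [AddCommMonoid M] [Module R M]
    {s : Set ι} {N : Submodule R M} (φ : (ι →₀ R) →ₗ[R] M)
    (h : ∀ a ∈ s, φ (Finsupp.single a 1) ∈ N) {f : ι →₀ R} (hf : f ∈ Finsupp.supported R R s) :
    φ f ∈ N := by
  rw [Finsupp.supported_eq_span_single] at hf
  refine (Submodule.map_span_le φ _ N).2 ?_ (Submodule.mem_map_of_mem hf)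
  rintro _ ⟨a, ha, rfl⟩
  exact h a ha

theorem sub_single_add_single {ι : Type*} [DecidableEq ι] {α : ι → ℕ} {i : ι} (h : α i ≠ 0) :
    α - Pi.single i 1 + Pi.single i 1 = α := by
  refine tsub_add_cancel_of_le fun j => ?_
  rcases eq_or_ne j i with rfl | hj
  · simpa using Nat.one_le_iff_ne_zero.2 h
  · simp [hj]

theorem sum_add_single {ι : Type*} [Fintype ι] [DecidableEq ι] (α : ι → ℕ) (i : ι) :
    ∑ j, (α + Pi.single i 1 : ι → ℕ) j = ∑ j, α j + 1 := by
  simp [sum_add_distrib]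

theorem sum_sub_single_add_one {ι : Type*} [Fintype ι] [DecidableEq ι] {α : ι → ℕ} {i : ι}
    (h : α i ≠ 0) : ∑ j, (α - Pi.single i 1 : ι → ℕ) j + 1 = ∑ j, α j := by
  rw [← sum_add_single, sub_single_add_single h]

theorem exists_eq_single_of_sum_le_one {ι : Type*} [Fintype ι] [DecidableEq ι] {α : ι → ℕ}
    (h0 : α ≠ 0) (hα : ∑ i, α i ≤ 1) : ∃ i, α = Pi.single i 1 := by
  obtain ⟨i, hi⟩ := Function.ne_iff.1 h0
  have hsum : ∑ j, (α - Pi.single i 1 : ι → ℕ) j = 0 := by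
    have := sum_sub_single_add_one hi
    omega
  refine ⟨i, (sub_single_add_single hi).symm.trans ?_⟩
  rw [funext fun j => sum_eq_zero_iff.1 hsum j (mem_univ j), Pi.add_def]
  simp

/-- The degree `|α| + |u|` of the monomial `x^(α) x^u`. -/
def monoDegree (a : Mono n) : ℕ := ∑ i, a.1 i + #a.2

theorem mul_mem_degPart {d e : ℤ} {f g : DPS F n} (hf : f ∈ degPart F n d)
    (hg : g ∈ degPart F n e) : mul F n f g ∈ degPart F n (d + e) := by
  refine map_mem_of_mem_supported ((mul F n).flip g) (fun a ha => ?_) hf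
  refine map_mem_of_mem_supported (mul F n (Finsupp.single a 1)) (fun b hb => ?_) hg
  simp only [Set.mem_ofPred_eq] at ha hb
  rw [mul_single]
  by_cases h : Disjoint a.2 b.2
  · refine Finsupp.single_mem_supported F _ ?_
    simp only [Set.mem_ofPred_eq, card_union_of_disjoint h, Pi.add_apply, sum_add_distrib]
    omega
  · obtain ⟨i, hi, hi'⟩ := not_disjoint_iff.1 h
    simp [mulCoeff, wedgeSign_eq_zero hi hi']

theorem pd_mem_degPart (r : Ind n) {d : ℤ} {f : DPS F n} (hf : f ∈ degPart F n d) :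
    pd F n r f ∈ degPart F n (d - 1) := by
  refine map_mem_of_mem_supported (pd F n r) (fun a ha => ?_) hf
  simp only [Set.mem_ofPred_eq] at ha
  rcases r with i | k
  · rw [pd_even_single]
    split_ifs with h
    · exact zero_mem _
    · have := sum_sub_single_add_one h
      refine Finsupp.single_mem_supported F _ ?_
      simp only [Set.mem_ofPred_eq]
      omega
  · rw [pd_odd_single]
    split_ifs with h
    · have := card_erase_add_one h
      refine Finsupp.single_mem_supported F _ ?_
      simp only [Set.mem_ofPred_eq]
      omega
    · exact zero_mem _

theorem hc_mem_degPart {d : ℤ} {a : DPS F n} (h1 : a ∈ parityPart F n 1)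
    (ha : a ∈ degPart F n d) (r : Ind n) : hc a r ∈ degPart F n (d - 1) := by
  rw [hc_eq h1]
  exact Submodule.smul_mem _ _ (pd_mem_degPart _ ha)

theorem vf_mem_degPart {d e : ℤ} {f : Ind n → DPS F n} (hf : ∀ r, f r ∈ degPart F n (d + 1))
    {a : DPS F n} (ha : a ∈ degPart F n e) : vf F n f a ∈ degPart F n (d + e) := by
  rw [vf_apply]
  refine Submodule.sum_mem _ fun r _ => ?_
  have := mul_mem_degPart (hf r) (pd_mem_degPart r ha)
  rwa [show d + 1 + (e - 1) = d + e by ring] at this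

end Degree

section Products

variable {F : Type*} [Field F] {n : ℕ}

theorem pd_even_apply (i : Fin n) (f : DPS F n) (a : Mono n) :
    pd F n (Sum.inl i) f a = f (a.1 + Pi.single i 1, a.2) := by
  induction f using Finsupp.induction_linear with
  | zero => simp
  | add f₁ f₂ h₁ h₂ => simp only [map_add, Finsupp.add_apply, h₁, h₂]
  | single b c =>
    rw [pd_even_single]
    split_ifs with h
    · have hb : (a.1 + Pi.single i 1, a.2) ≠ b := by
        rintro rfl
        simp at h
      rw [Finsupp.single_eq_of_ne hb, Finsupp.zero_apply]
    · have hb : (b.1 - Pi.single i 1, b.2) = a ↔ b = (a.1 + Pi.single i 1, a.2) := by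
        simp only [Prod.ext_iff]
        refine and_congr_left fun _ => ⟨fun h' => ?_, fun h' => ?_⟩
        · rw [← h', sub_single_add_single h]
        · rw [h', add_tsub_cancel_right]
      simp only [Finsupp.single_apply, hb]

theorem apply_eq_pd_even_apply (f : DPS F n) {a : Mono n} {i : Fin n} (h : a.1 i ≠ 0) :
    f a = pd F n (Sum.inl i) f (a.1 - Pi.single i 1, a.2) := by
  rw [pd_even_apply, sub_single_add_single h]

theorem const_mul (f : DPS F n) (c : F) : mul F n (Finsupp.single (0, ∅) c) f = c • f := by
  induction f using Finsupp.induction_linear with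
  | zero => simp
  | add f₁ f₂ h₁ h₂ => rw [map_add, h₁, h₂, smul_add]
  | single a c => rw [mul_single]; simp [mulCoeff, wedgeSign]

theorem mulCoeff_var_left (i : Fin n) (a : Mono n) :
    mulCoeff (Pi.single i 1, ∅) a = a.1 i + 1 := by
  simp only [mulCoeff, wedgeSign, prod_empty, mul_one]
  rw [prod_eq_single i]
  · simp [add_comm 1]
  · intro j _ h
    simp [h]
  · simp

theorem mulCoeff_odd_left (v : Finset (Fin n)) (a : Mono n) :
    mulCoeff (0, v) a = wedgeSign v a.2 := by
  simp [mulCoeff]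

theorem mulCoeff_odd_right (a : Mono n) (v : Finset (Fin n)) :
    mulCoeff a (0, v) = wedgeSign a.2 v := by
  simp [mulCoeff]

theorem wedgeSign_cast_ne_zero {u v : Finset (Fin n)} (h : Disjoint u v) :
    ((wedgeSign u v : ℤ) : F) ≠ 0 := by
  simp only [wedgeSign, Int.cast_prod, prod_ne_zero_iff]
  intro i hi j hj
  have hij : i ≠ j := fun e => disjoint_left.1 h hi (e ▸ hj)
  rcases lt_or_gt_of_ne hij with h | h <;> simp [pairSign, h, h.not_gt]

theorem odd_mul_pd_odd_single (i j : Fin n) (a : Mono n) (c : F) :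
    mul F n (var (Sum.inr j)) (pd F n (Sum.inr i) (Finsupp.single a c)) =
      if i ∈ a.2 then Finsupp.single (a.1, insert j (a.2.erase i))
        (c * ((wedgeSign {i} (a.2.erase i) * wedgeSign {j} (a.2.erase i) : ℤ) : F)) else 0 := by
  rw [pd_odd_single]
  split_ifs with h
  · rw [var, mul_single, mulCoeff_odd_left]
    simp only [zero_add, one_mul, ← insert_eq]
    push_cast
    rw [mul_assoc]
  · rw [map_zero]

theorem odd_euler_single (i : Fin n) (a : Mono n) (c : F) :
    mul F n (var (Sum.inr i)) (pd F n (Sum.inr i) (Finsupp.single a c)) =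
      if i ∈ a.2 then Finsupp.single a c else 0 := by
  rw [odd_mul_pd_odd_single]
  split_ifs with h
  · rw [wedgeSign_sq (notMem_erase i a.2), insert_erase h, Int.cast_one, mul_one]
  · rfl

theorem even_euler_single (i : Fin n) (a : Mono n) (c : F) :
    mul F n (var (Sum.inl i)) (pd F n (Sum.inl i) (Finsupp.single a c)) =
      Finsupp.single a (c * (a.1 i : F)) := by
  rw [pd_even_single]
  split_ifs with h
  · simp [h]
  · obtain ⟨m, hm⟩ := Nat.exists_eq_succ_of_ne_zero h
    rw [var, mul_single, mulCoeff_var_left, add_comm, sub_single_add_single h]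
    simp [hm]

theorem vf_const (f : Ind n → DPS F n) (c : F) : vf F n f (Finsupp.single (0, ∅) c) = 0 := by
  rw [vf_apply]
  refine sum_eq_zero fun r _ => ?_
  rcases r with i | i
  · simp [pd_even_single]
  · simp [pd_odd_single]

end Products

section HamiltonianFields

variable {F : Type*} [Field F] {n : ℕ}

theorem var_odd_mem_parityPart (i : Fin n) : (var (Sum.inr i) : DPS F n) ∈ parityPart F n 1 :=
  single_mem_parityPart _ rfl

theorem TH_var (i : Fin n) (f : DPS F n) :
    TH F n (var (Sum.inr i)) f = -pd F n (Sum.inl i) f := by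
  rw [TH_apply_odd (var_odd_mem_parityPart i), sum_eq_single (Sum.inr i)]
  · rw [pd_var, if_pos rfl, const_mul]
    simp [par]
  · intro r _ h
    rw [pd_var, if_neg h, map_zero, LinearMap.zero_apply, smul_zero]
  · simp

theorem hc_var (i : Fin n) (s : Ind n) :
    hc (var (Sum.inr i) : DPS F n) s =
      Finsupp.single (0, ∅) (if s = Sum.inl i then -1 else 0) := by
  rw [hc_eq (var_odd_mem_parityPart i), pd_var]
  rcases s with l | l
  · by_cases h : l = i <;> simp [h, par]
  · simp

/-- The element `x_i x_{j'}` of `𝒪(n,n)`. The fields `T_H(x_i x_{i'})` span a torus of `ℋ𝒪`. -/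
def varMul (F : Type*) [Field F] {n : ℕ} (i j : Fin n) : DPS F n :=
  Finsupp.single (Pi.single i 1, {j}) 1

theorem varMul_mem_parityPart (i j : Fin n) : varMul F i j ∈ parityPart F n 1 :=
  single_mem_parityPart _ rfl

theorem pd_varMul (i j : Fin n) (r : Ind n) : pd F n r (varMul F i j) =
    if r = Sum.inl i then var (Sum.inr j) else if r = Sum.inr j then var (Sum.inl i) else 0 := by
  rcases r with l | l
  · by_cases h : l = i
    · subst h; simp [varMul, var, pd_even_single]
    · simp [varMul, pd_even_single, h]
  · by_cases h : l = j
    · subst h; simp [varMul, var, pd_odd_single, wedgeSign]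
    · simp [varMul, pd_odd_single, h]

theorem TH_varMul (i j : Fin n) (f : DPS F n) :
    TH F n (varMul F i j) f = mul F n (var (Sum.inr j)) (pd F n (Sum.inr i) f) -
      mul F n (var (Sum.inl i)) (pd F n (Sum.inl j) f) := by
  rw [TH_apply_odd (varMul_mem_parityPart i j), Fintype.sum_sum_type, sum_eq_single i,
    sum_eq_single j]
  · simp [pd_varMul, par, sub_eq_add_neg]
  · intro l _ h; simp [pd_varMul, h]
  · simp
  · intro l _ h; simp [pd_varMul, h]
  · simp

theorem hc_varMul (i j : Fin n) (s : Ind n) :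
    hc (varMul F i j) s = if s = Sum.inl j then -var (Sum.inl i) else
      if s = Sum.inr i then var (Sum.inr j) else 0 := by
  rw [hc_eq (varMul_mem_parityPart i j), pd_varMul]
  rcases s with l | l
  · by_cases h : l = j <;> simp [h, par]
  · by_cases h : l = i <;> simp [h, par]

theorem TH_single_apply_single {a b : Mono n} (ha : #a.2 ≡ 1 [MOD 2]) (hb : b.1 = 0) (c : F) :
    TH F n (Finsupp.single a 1) (Finsupp.single b c) =
      ∑ k, mul F n (pd F n (Sum.inl k) (Finsupp.single a 1))
        (pd F n (Sum.inr k) (Finsupp.single b c)) := by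
  rw [TH_apply_odd (single_mem_parityPart _ ha), Fintype.sum_sum_type]
  have : ∀ k : Fin n, pd F n (Sum.inl k) (Finsupp.single b c) = 0 := fun k => by
    rw [pd_even_single, hb, Pi.zero_apply, if_pos rfl]
  simp [this, par]

/-- The hypothesis `hk` says that only `∂_i` and `∂_{i'}` contribute to the bracket. -/
theorem exists_TH_single_apply_single {a : Mono n} {w : Finset (Fin n)} {i : Fin n}
    (ha : #a.2 ≡ 1 [MOD 2]) (hi : i ∈ w) (hai : a.1 i ≠ 0) (hd : Disjoint a.2 (w.erase i))
    (hk : ∀ k ∈ w, k ≠ i → a.1 k ≠ 0 → ¬ Disjoint a.2 (w.erase k)) :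
    ∃ c : F, c ≠ 0 ∧ TH F n (Finsupp.single a 1) (Finsupp.single (0, w) 1) =
      Finsupp.single (a.1 - Pi.single i 1, a.2 ∪ w.erase i) c := by
  refine ⟨(wedgeSign {i} (w.erase i) : ℤ) * (wedgeSign a.2 (w.erase i) : ℤ),
    mul_ne_zero (wedgeSign_cast_ne_zero (by simp)) (wedgeSign_cast_ne_zero hd), ?_⟩
  rw [TH_single_apply_single ha rfl, sum_eq_single i]
  · rw [pd_even_single, if_neg hai, pd_odd_single, if_pos hi, mul_single, mulCoeff_odd_right]
    simp
  · intro k _ hki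
    rw [pd_even_single, pd_odd_single]
    by_cases h1 : a.1 k = 0
    · simp [h1]
    by_cases h2 : k ∈ w
    · obtain ⟨j, hj, hj'⟩ := not_disjoint_iff.1 (hk k h2 hki h1)
      rw [if_neg h1, if_pos h2, mul_single, mulCoeff_odd_right]
      simp [wedgeSign_eq_zero hj hj']
    · simp [h2]
  · simp

/-- The eigenvalue of `T_H(x_i x_{i'})` on the monomial `a`, as an integer. -/
def monoWeight (i : Fin n) (a : Mono n) : ℤ := (if i ∈ a.2 then 1 else 0) - a.1 i

/-- The eigenvalue of `ad T_H(x_i x_{i'})` on the field `x^a ∂_s`, as an integer. -/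
def fieldWeight (i : Fin n) (s : Ind n) (a : Mono n) : ℤ :=
  monoWeight i a + (if s = Sum.inl i then 1 else 0) - if s = Sum.inr i then 1 else 0

theorem TH_varMul_self_single (i : Fin n) (a : Mono n) (c : F) :
    TH F n (varMul F i i) (Finsupp.single a c) = Finsupp.single a ((monoWeight i a : F) * c) := by
  rw [TH_varMul, odd_euler_single, even_euler_single, monoWeight, Int.cast_sub, sub_mul,
    Finsupp.single_sub, mul_comm c]
  split_ifs <;> simp

theorem TH_varMul_self_apply (i : Fin n) (f : DPS F n) (a : Mono n) :
    TH F n (varMul F i i) f a = monoWeight i a * f a := by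
  induction f using Finsupp.induction_linear with
  | zero => simp
  | add f₁ f₂ h₁ h₂ => simp only [map_add, Finsupp.add_apply, h₁, h₂, mul_add]
  | single b c =>
    rw [TH_varMul_self_single, Finsupp.single_apply, Finsupp.single_apply]
    split_ifs with h
    · rw [h]
    · rw [mul_zero]

theorem lie_varMul_self_apply (i : Fin n) (f : Ind n → DPS F n) (s : Ind n) (a : Mono n) :
    (TH F n (varMul F i i) (f s) - vf F n f (hc (varMul F i i) s)) a =
      fieldWeight i s a * f s a := by
  rw [Finsupp.sub_apply, TH_varMul_self_apply, hc_varMul, fieldWeight]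
  rcases s with l | l
  · by_cases h : l = i
    · subst h; simp [vf_var]; ring
    · simp [h]
  · by_cases h : l = i
    · subst h; simp [vf_var]; ring
    · simp [h]

/-- The coefficients of the vector field `∑ b_j x_{j'} ∂_{j'}`. -/
def oddDiag (b : Fin n → F) : Ind n → DPS F n
  | Sum.inl _ => 0
  | Sum.inr j => b j • var (Sum.inr j)

theorem vf_oddDiag_single (b : Fin n → F) (a : Mono n) (c : F) :
    vf F n (oddDiag b) (Finsupp.single a c) = Finsupp.single a ((∑ j ∈ a.2, b j) * c) := by
  simp only [vf_apply, Fintype.sum_sum_type, oddDiag, map_zero, map_smul, LinearMap.zero_apply,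
    LinearMap.smul_apply, odd_euler_single, sum_const_zero, zero_add, smul_ite, smul_zero]
  rw [← sum_filter, filter_mem_eq_inter, univ_inter, sum_mul, Finsupp.single_finsetSum]
  simp only [Finsupp.smul_single, smul_eq_mul]

end HamiltonianFields

section Coefficients

variable {F : Type*} [Field F] {p : ℕ} [Fact p.Prime] [CharP F p] {n : ℕ} {t : Fin n → ℕ}

/-- The coefficients `f_s` of an element `∑ f_s ∂_s` of `𝒲`. -/
def coeff : wittEven F p t →ₗ[F] Ind n → DPS F n where
  toFun V s := (V : Module.End F (DPS F n)) (var s)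
  map_add' _ _ := rfl
  map_smul' _ _ := rfl

theorem coe_eq_vf_coeff (V : wittEven F p t) : (V : Module.End F (DPS F n)) = vf F n (coeff V) := by
  obtain ⟨_, f, hf, rfl⟩ := V
  exact congrArg (vf F n) (funext fun s => (vf_var f s).symm)

theorem coeff_injective : Function.Injective (coeff : wittEven F p t → Ind n → DPS F n) :=
  fun V W h => Subtype.ext (by rw [coe_eq_vf_coeff, coe_eq_vf_coeff, h])

theorem eq_zero_of_coeff_eq_zero {V : wittEven F p t} (h : ∀ s a, coeff V s a = 0) : V = 0 :=
  coeff_injective (funext fun s => Finsupp.ext (h s))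

theorem coeff_mem (V : wittEven F p t) (s : Ind n) :
    coeff V s ∈ trunc F p t ⊓ parityPart F n (par s) := by
  obtain ⟨_, f, hf, rfl⟩ := V
  change vf F n f (var s) ∈ _
  rw [vf_var]
  exact hf s trivial

theorem coeff_lie (V W : wittEven F p t) (s : Ind n) :
    coeff ⁅V, W⁆ s = vf F n (coeff V) (coeff W s) - vf F n (coeff W) (coeff V s) := by
  rw [← coe_eq_vf_coeff, ← coe_eq_vf_coeff]
  rfl

theorem mem_wittEvenDeg_iff {V : wittEven F p t} {d : ℤ} :
    V ∈ wittEvenDeg F p t d ↔ ∀ s, coeff V s ∈ degPart F n (d + 1) := by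
  constructor
  · rintro ⟨f, hf, h⟩ s
    have : coeff V s = f s := by
      rw [← vf_var f s, h]
      rfl
    rw [this]
    exact (hf s trivial).2
  · exact fun h => ⟨coeff V, fun s _ => ⟨(coeff_mem V s).1, h s⟩, (coe_eq_vf_coeff V).symm⟩

/-- The fields `x^a ∂_s` with `IsWittMono p t d s a` are the standard basis of `𝒲_d`. -/
def IsWittMono (p : ℕ) (t : Fin n → ℕ) (d : ℤ) (s : Ind n) (a : Mono n) : Prop :=
  (∀ i, a.1 i ≤ p ^ t i - 1) ∧ #a.2 ≡ par s [MOD 2] ∧ (monoDegree a : ℤ) = d + 1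

theorem isWittMono_of_coeff_ne_zero {V : wittEven F p t} {d : ℤ} (hV : V ∈ wittEvenDeg F p t d)
    {s : Ind n} {a : Mono n} (h : coeff V s a ≠ 0) : IsWittMono p t d s a := by
  have ha : a ∈ ((coeff V s).support : Set (Mono n)) := by simpa using h
  exact ⟨(Finsupp.mem_supported F _).1 (coeff_mem V s).1 ha,
    (Finsupp.mem_supported F _).1 (coeff_mem V s).2 ha,
    (Finsupp.mem_supported F _).1 (mem_wittEvenDeg_iff.1 hV s) ha⟩

theorem exists_mem_wittEvenDeg_coeff_eq {d : ℤ} {f : Ind n → DPS F n}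
    (hf : ∀ s a, f s a ≠ 0 → IsWittMono p t d s a) :
    ∃ E ∈ wittEvenDeg F p t d, coeff E = f := by
  have mem_supported : ∀ s (S : Set (Mono n)), (∀ a, IsWittMono p t d s a → a ∈ S) →
      f s ∈ Finsupp.supported F F S := fun s S h =>
    (Finsupp.mem_supported F _).2 fun a ha => h a (hf s a (by simpa using ha))
  let E : wittEven F p t := ⟨vf F n f, f, fun s _ =>
    ⟨mem_supported s _ fun _ h => h.1, mem_supported s _ fun _ h => h.2.1⟩, rfl⟩
  have hE : coeff E = f := funext (vf_var f)
  refine ⟨E, mem_wittEvenDeg_iff.2 fun s => ?_, hE⟩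
  rw [hE]
  exact mem_supported s _ fun _ h => h.2.2

theorem lie_mem_wittEvenDeg {V W : wittEven F p t} {d e : ℤ} (hV : V ∈ wittEvenDeg F p t d)
    (hW : W ∈ wittEvenDeg F p t e) : ⁅V, W⁆ ∈ wittEvenDeg F p t (d + e) := by
  rw [mem_wittEvenDeg_iff] at *
  intro s
  rw [coeff_lie]
  refine sub_mem ?_ ?_
  · rw [add_assoc]
    exact vf_mem_degPart hV (hW s)
  · rw [add_comm d, add_assoc]
    exact vf_mem_degPart hW (hV s)

theorem adW_mem_derDeg {E : wittEven F p t} {d : ℤ} (hE : E ∈ wittEvenDeg F p t d) :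
    adW F p t E ∈ derDeg F p t d := fun i x hx => by
  rw [adW_apply]
  exact lie_mem_wittEvenDeg hE hx

theorem sub_adW_apply (D : LieDerivation F (hoEven F p t) (wittEven F p t)) (E : wittEven F p t)
    (x : hoEven F p t) : (D - adW F p t E) x = D x + ⁅x, E⁆ := by
  rw [LieDerivation.sub_apply, adW_apply, ← lie_skew, sub_neg_eq_add]
  rfl

end Coefficients

section Hamiltonian

variable {F : Type*} [Field F] {p : ℕ} {n : ℕ} {t : Fin n → ℕ}

/-- The fields `T_H(x^b)` with `IsOddMono p t b` span `ℋ𝒪`. -/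
def IsOddMono (p : ℕ) (t : Fin n → ℕ) (b : Mono n) : Prop :=
  (∀ i, b.1 i ≤ p ^ t i - 1) ∧ #b.2 ≡ 1 [MOD 2]

theorem IsOddMono.mono {b c : Mono n} (hb : IsOddMono p t b) (h : c.1 ≤ b.1)
    (hcb : #c.2 ≡ 1 [MOD 2]) : IsOddMono p t c :=
  ⟨fun i => (h i).trans (hb.1 i), hcb⟩

theorem IsOddMono.sub_single {b : Mono n} (hb : IsOddMono p t b) (i : Fin n) :
    IsOddMono p t (b.1 - Pi.single i 1, b.2) :=
  hb.mono tsub_le_self hb.2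

theorem isOddMono_zero {u : Finset (Fin n)} (hu : #u ≡ 1 [MOD 2]) : IsOddMono p t (0, u) :=
  ⟨fun _ => Nat.zero_le _, hu⟩

/-- The span of the odd monomials of `𝒪(n,n;t)`. -/
def oddTrunc (F : Type*) [Field F] (p : ℕ) (t : Fin n → ℕ) : Submodule F (DPS F n) :=
  trunc F p t ⊓ parityPart F n 1

theorem oddTrunc_eq_supported :
    oddTrunc F p t = Finsupp.supported F F {b | IsOddMono p t b} :=
  (Finsupp.supported_inter _ _).symm

theorem single_mem_oddTrunc {b : Mono n} (hb : IsOddMono p t b) (c : F) :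
    Finsupp.single b c ∈ oddTrunc F p t :=
  ⟨Finsupp.single_mem_supported F c hb.1, single_mem_parityPart c hb.2⟩

theorem var_odd_mem_oddTrunc (i : Fin n) : (var (Sum.inr i) : DPS F n) ∈ oddTrunc F p t :=
  single_mem_oddTrunc (b := (0, {i})) (isOddMono_zero rfl) 1

variable [Fact p.Prime]

theorem one_le_pow_sub_one (ht : ∀ i, 1 ≤ t i) (i : Fin n) : 1 ≤ p ^ t i - 1 := by
  have := Nat.one_lt_pow (Nat.one_le_iff_ne_zero.1 (ht i)) (Fact.out : p.Prime).one_lt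
  omega

theorem isOddMono_single (ht : ∀ i, 1 ≤ t i) (i : Fin n) {u : Finset (Fin n)}
    (hu : #u ≡ 1 [MOD 2]) : IsOddMono p t (Pi.single i 1, u) := by
  refine ⟨fun j => ?_, hu⟩
  have := one_le_pow_sub_one (p := p) ht j
  rcases eq_or_ne j i with rfl | h
  · simpa using this
  · simp [h]

theorem varMul_mem_oddTrunc (ht : ∀ i, 1 ≤ t i) (i j : Fin n) : varMul F i j ∈ oddTrunc F p t :=
  single_mem_oddTrunc (isOddMono_single ht i (u := {j}) rfl) 1

variable [CharP F p]

theorem TH_mem_oddTrunc {a b : DPS F n} (ha : a ∈ oddTrunc F p t) (hb : b ∈ oddTrunc F p t) :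
    TH F n a b ∈ oddTrunc F p t := by
  rw [TH_eq]
  exact ⟨vf_mem_trunc (hc_mem_trunc ha.1) hb.1, vf_mem_parityPart (hc_mem_parityPart_one ha.2) hb.2⟩

open Classical in
/-- The map `a ↦ T_H(a)` from the odd part of `𝒪(n,n;t)` onto `ℋ𝒪`, extended by `0` to the other
monomials. -/
def hamiltonian : DPS F n →ₗ[F] hoEven F p t :=
  Finsupp.linearCombination F fun b =>
    if hb : IsOddMono p t b then
      have hb := single_mem_oddTrunc hb (1 : F)
      ⟨⟨TH F n (Finsupp.single b 1), ((mem_hoEven_iff _).2 ⟨_, hb.1, hb.2, rfl⟩).2⟩, _, hb.1, rfl⟩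
    else 0

theorem coe_hamiltonian {a : DPS F n} (ha : a ∈ oddTrunc F p t) :
    ((hamiltonian a : hoEven F p t) : Module.End F (DPS F n)) = TH F n a := by
  rw [oddTrunc_eq_supported] at ha
  refine sub_eq_zero.1 ((Submodule.mem_bot F).1 (map_mem_of_mem_supported
    ((wittEven F p t).toSubmodule.subtype ∘ₗ (hoEven F p t).toSubmodule.subtype ∘ₗ hamiltonian -
      TH F n) (fun b hb => ?_) ha))
  have hb' : IsOddMono p t b := hb
  simp [hamiltonian, hb']

theorem exists_hamiltonian_eq (x : hoEven F p t) : ∃ a ∈ oddTrunc F p t, hamiltonian a = x := by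
  obtain ⟨a, ha, h1, h⟩ := (mem_hoEven_iff _).1 ⟨x.2, x.1.2⟩
  exact ⟨a, ⟨ha, h1⟩, Subtype.ext (Subtype.ext ((coe_hamiltonian ⟨ha, h1⟩).trans h))⟩

theorem linearMap_eq_zero_of_hamiltonian {M : Type*} [AddCommGroup M] [Module F M]
    (φ : hoEven F p t →ₗ[F] M)
    (h : ∀ b, IsOddMono p t b → φ (hamiltonian (Finsupp.single b 1)) = 0) : φ = 0 := by
  ext x
  obtain ⟨a, ha, rfl⟩ := exists_hamiltonian_eq x
  rw [oddTrunc_eq_supported] at ha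
  exact (Submodule.mem_bot F).1 (map_mem_of_mem_supported (φ ∘ₗ hamiltonian) h ha)

theorem hamiltonian_lie {a b : DPS F n} (ha : a ∈ oddTrunc F p t) (hb : b ∈ oddTrunc F p t) :
    ⁅(hamiltonian a : hoEven F p t), (hamiltonian b : hoEven F p t)⁆ =
      hamiltonian (TH F n a b) := by
  refine Subtype.ext (Subtype.ext ?_)
  rw [coe_hamiltonian (TH_mem_oddTrunc ha hb), ← TH_lie ha.2 hb.2, ← coe_hamiltonian ha,
    ← coe_hamiltonian hb]
  rfl

theorem coeff_hamiltonian {a : DPS F n} (ha : a ∈ oddTrunc F p t) :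
    coeff ((hamiltonian a : hoEven F p t) : wittEven F p t) = hc a := by
  refine vf_injective ?_
  rw [← coe_eq_vf_coeff, coe_hamiltonian ha, TH_eq]

theorem coeff_lie_hamiltonian {a : DPS F n} (ha : a ∈ oddTrunc F p t) (V : wittEven F p t)
    (s : Ind n) : coeff ⁅(hamiltonian a : hoEven F p t), V⁆ s =
      TH F n a (coeff V s) - vf F n (coeff V) (hc a s) := by
  change coeff ⁅((hamiltonian a : hoEven F p t) : wittEven F p t), V⁆ s = _
  rw [coeff_lie, coeff_hamiltonian ha, ← TH_eq]

theorem coeff_lie_hamiltonian_var (i : Fin n) (V : wittEven F p t) (s : Ind n) :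
    coeff ⁅(hamiltonian (var (Sum.inr i)) : hoEven F p t), V⁆ s =
      -pd F n (Sum.inl i) (coeff V s) := by
  rw [coeff_lie_hamiltonian (var_odd_mem_oddTrunc i), TH_var, hc_var, vf_const, sub_zero]

theorem coeff_lie_hamiltonian_varMul_self (ht : ∀ i, 1 ≤ t i) (i : Fin n) (V : wittEven F p t)
    (s : Ind n) (a : Mono n) : coeff ⁅(hamiltonian (varMul F i i) : hoEven F p t), V⁆ s a =
      fieldWeight i s a * coeff V s a := by
  rw [coeff_lie_hamiltonian (varMul_mem_oddTrunc ht i i), lie_varMul_self_apply]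

theorem hamiltonian_mem_hoEvenDeg {b : Mono n} (hb : IsOddMono p t b) :
    (hamiltonian (Finsupp.single b 1) : hoEven F p t) ∈ hoEvenDeg F p t (monoDegree b - 2) := by
  refine mem_wittEvenDeg_iff.2 fun s => ?_
  have hb' := single_mem_oddTrunc hb (1 : F)
  change coeff ((hamiltonian (Finsupp.single b 1) : hoEven F p t) : wittEven F p t) s ∈ _
  rw [coeff_hamiltonian hb', show (monoDegree b - 2 + 1 : ℤ) = monoDegree b - 1 by ring]
  exact hc_mem_degPart hb'.2 (Finsupp.single_mem_supported F _ rfl) s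

theorem isWittMono_of_coeff_apply_ne_zero {D : LieDerivation F (hoEven F p t) (wittEven F p t)}
    {d : ℤ} (hD : D ∈ derDeg F p t d) {b : Mono n} (hb : IsOddMono p t b) {s : Ind n} {a : Mono n}
    (h : coeff (D (hamiltonian (Finsupp.single b 1))) s a ≠ 0) :
    IsWittMono p t (d + (monoDegree b - 2)) s a :=
  isWittMono_of_coeff_ne_zero (hD _ _ (hamiltonian_mem_hoEvenDeg hb)) h

end Hamiltonian

section CharP

variable {R L M : Type*} [CommRing R] [LieRing L] [LieAlgebra R L] [AddCommGroup M] [Module R M]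
  [LieRingModule L M] [LieModule R L M]

theorem toEnd_linearMap_pow_char_pow_apply (p : ℕ) [Fact p.Prime] [CharP R p] (k : ℕ) (x : L)
    (f : L →ₗ[R] M) : (LieModule.toEnd R L (L →ₗ[R] M) x ^ p ^ k) f =
      (LieModule.toEnd R L M x ^ p ^ k) ∘ₗ f - f ∘ₗ (LieModule.toEnd R L L x ^ p ^ k) := by
  let post (A : Module.End R M) : Module.End R (L →ₗ[R] M) := LinearMap.llcomp R L M M A
  let pre (B : Module.End R L) : Module.End R (L →ₗ[R] M) := LinearMap.lcomp R M B
  have post_pow : ∀ A m, post A ^ m = post (A ^ m) := fun A m => by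
    induction m with
    | zero => rfl
    | succ m ih => rw [pow_succ', ih, pow_succ']; rfl
  have pre_pow : ∀ B m, pre B ^ m = pre (B ^ m) := fun B m => by
    induction m with
    | zero => rfl
    | succ m ih => rw [pow_succ', ih, pow_succ]; rfl
  have toEnd_eq : LieModule.toEnd R L (L →ₗ[R] M) x =
      post (LieModule.toEnd R L M x) - pre (LieModule.toEnd R L L x) := rfl
  rcases subsingleton_or_nontrivial (Module.End R (L →ₗ[R] M)) with _ | _
  · exact congrArg (fun φ : Module.End R (L →ₗ[R] M) => φ f) (Subsingleton.elim _
      (post (LieModule.toEnd R L M x ^ p ^ k) - pre (LieModule.toEnd R L L x ^ p ^ k)))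
  · have : CharP (Module.End R (L →ₗ[R] M)) p :=
      (CharP.charP_iff_prime_eq_zero Fact.out).2 <| by
        rw [← map_natCast (algebraMap R _), CharP.cast_eq_zero, map_zero]
    have hcomm : Commute (post (LieModule.toEnd R L M x)) (pre (LieModule.toEnd R L L x)) :=
      LinearMap.ext fun f => LinearMap.ext fun z => rfl
    rw [toEnd_eq, sub_pow_char_pow_of_commute (p := p) (h := hcomm), post_pow, pre_pow]
    rfl

theorem toEnd_linearMap_pow_succ_derivation_apply (D : LieDerivation R L M) (x y : L) (m : ℕ) :
    (LieModule.toEnd R L (L →ₗ[R] M) x ^ (m + 1)) (D : L →ₗ[R] M) y =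
      ⁅y, (LieModule.toEnd R L M x ^ m) (D x)⁆ := by
  induction m generalizing y with
  | zero =>
    change ⁅x, D y⁆ - D ⁅x, y⁆ = ⁅y, D x⁆
    rw [LieDerivation.apply_lie_eq_sub, sub_sub_cancel]
  | succ m ih =>
    rw [pow_succ', Module.End.mul_apply, LieModule.toEnd_apply_apply, LieHom.lie_apply, ih, ih,
      pow_succ', Module.End.mul_apply, LieModule.toEnd_apply_apply, leibniz_lie x y,
      add_sub_cancel_left]

theorem lie_toEnd_pow_derivation_eq_zero (p : ℕ) [Fact p.Prime] [CharP R p] (k : ℕ)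
    (D : LieDerivation R L M) (x : L) (hL : LieModule.toEnd R L L x ^ p ^ k = 0)
    (hM : LieModule.toEnd R L M x ^ p ^ k = 0) (y : L) :
    ⁅y, (LieModule.toEnd R L M x ^ (p ^ k - 1)) (D x)⁆ = 0 := by
  have hpos : 0 < p ^ k := pow_pos (Fact.out : p.Prime).pos k
  rw [← toEnd_linearMap_pow_succ_derivation_apply, Nat.sub_add_cancel hpos,
    toEnd_linearMap_pow_char_pow_apply, hL, hM, LinearMap.zero_comp, LinearMap.comp_zero, sub_zero,
    LinearMap.zero_apply]

end CharP

section Antiderivative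

variable {F : Type*} [Field F] {n : ℕ}

theorem pd_even_pow_apply (i : Fin n) (m : ℕ) (f : DPS F n) (a : Mono n) :
    (pd F n (Sum.inl i) ^ m) f a = f (a.1 + Pi.single i m, a.2) := by
  induction m generalizing a with
  | zero => simp
  | succ m ih =>
    rw [pow_succ', Module.End.mul_apply, pd_even_apply, ih, add_assoc, ← Pi.single_add, add_comm 1]

theorem exists_antiderivative (g : Fin n → DPS F n)
    (hg : ∀ i j, pd F n (Sum.inl i) (g j) = pd F n (Sum.inl j) (g i)) :
    ∃ G : DPS F n, (∀ i, pd F n (Sum.inl i) G = g i) ∧ ∀ a : Mono n, a.1 = 0 → G a = 0 := by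
  classical
  have lowered_eq : ∀ (a : Mono n) (i j : Fin n), a.1 i ≠ 0 → a.1 j ≠ 0 →
      g i (a.1 - Pi.single i 1, a.2) = g j (a.1 - Pi.single j 1, a.2) := by
    intro a i j hi hj
    rcases eq_or_ne i j with rfl | hij
    · rfl
    rw [apply_eq_pd_even_apply (g i) (i := j) (by simpa [hij.symm] using hj),
      apply_eq_pd_even_apply (g j) (i := i) (by simpa [hij] using hi), hg i j, tsub_right_comm]
  let G₀ : Mono n → F := fun a =>
    if h : ∃ i, a.1 i ≠ 0 then g h.choose (a.1 - Pi.single h.choose 1, a.2) else 0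
  have G₀_eq : ∀ (a : Mono n) (i : Fin n), a.1 i ≠ 0 → G₀ a = g i (a.1 - Pi.single i 1, a.2) := by
    intro a i hi
    have h : ∃ i, a.1 i ≠ 0 := ⟨i, hi⟩
    rw [show G₀ a = _ from dif_pos h]
    exact lowered_eq a _ i h.choose_spec hi
  have G₀_zero : ∀ a : Mono n, a.1 = 0 → G₀ a = 0 := fun a ha => dif_neg (by simp [ha])
  let S : Finset (Mono n) := univ.biUnion fun i =>
    (g i).support.image fun b => (b.1 + Pi.single i 1, b.2)
  have support_G₀ : ∀ a, G₀ a ≠ 0 → a ∈ S := by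
    intro a ha
    obtain ⟨i, hi⟩ := Function.ne_iff.1 (mt (G₀_zero a) ha)
    rw [G₀_eq a i hi] at ha
    exact mem_biUnion.2 ⟨i, mem_univ i, mem_image.2 ⟨_, Finsupp.mem_support_iff.2 ha,
      Prod.ext (sub_single_add_single hi) rfl⟩⟩
  refine ⟨Finsupp.onFinset S G₀ support_G₀, fun i => Finsupp.ext fun a => ?_, G₀_zero⟩
  rw [pd_even_apply, Finsupp.onFinset_apply, G₀_eq _ i (by simp), add_tsub_cancel_right]

end Antiderivative

section Centralizer

variable {F : Type*} [Field F] {n : ℕ}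

theorem hc_single_inl {b : Mono n} (hb : #b.2 ≡ 1 [MOD 2]) (l : Fin n) :
    hc (Finsupp.single b 1 : DPS F n) (Sum.inl l) =
      -pd F n (Sum.inr l) (Finsupp.single b 1) := by
  rw [hc_eq (single_mem_parityPart 1 hb)]
  simp [par]

theorem hc_single_inr {b : Mono n} (hb : #b.2 ≡ 1 [MOD 2]) (l : Fin n) :
    hc (Finsupp.single b 1 : DPS F n) (Sum.inr l) = pd F n (Sum.inl l) (Finsupp.single b 1) := by
  rw [hc_eq (single_mem_parityPart 1 hb)]
  simp [par]

theorem hc_single_inl_ne_zero {b : Mono n} (hb : #b.2 ≡ 1 [MOD 2]) {l : Fin n} (hl : l ∈ b.2) :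
    hc (Finsupp.single b 1 : DPS F n) (Sum.inl l) ≠ 0 := by
  rw [hc_single_inl hb, pd_odd_single, if_pos hl, one_mul, neg_ne_zero, Finsupp.single_ne_zero]
  exact wedgeSign_cast_ne_zero (by simp)

theorem lie_single_oddDiag {b : Mono n} (hb : #b.2 ≡ 1 [MOD 2]) (c : Fin n → F) (s : Ind n) :
    TH F n (Finsupp.single b 1) (oddDiag c s) -
      vf F n (oddDiag c) (hc (Finsupp.single b 1) s) =
        (Sum.elim c c s - ∑ j ∈ b.2, c j) • hc (Finsupp.single b 1) s := by
  rcases s with l | l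
  · rw [hc_single_inl hb, pd_odd_single]
    split_ifs with hl
    · rw [map_neg, vf_oddDiag_single, ← add_sum_erase b.2 c hl, oddDiag, map_zero]
      simp
    · simp [oddDiag]
  · have hl : TH F n (Finsupp.single b 1) (oddDiag c (Sum.inr l)) =
        c l • hc (Finsupp.single b 1) (Sum.inr l) := by
      rw [oddDiag, map_smul, TH_eq, vf_var]
    rw [hl, hc_single_inr hb, pd_even_single]
    split_ifs with h0
    · simp
    · simp only [vf_oddDiag_single, sub_smul, Finsupp.smul_single, smul_eq_mul, Sum.elim_inr]

theorem exists_eq_singleton_of_fieldWeight_eq_zero {s : Ind n} {a : Mono n} (h0 : a.1 = 0)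
    (h : ∀ i, fieldWeight i s a = 0) : ∃ l, s = Sum.inr l ∧ a = (0, {l}) := by
  simp only [fieldWeight, monoWeight, h0, Pi.zero_apply, Nat.cast_zero, sub_zero] at h
  rcases s with l | l
  · have := h l
    split_ifs at this <;> simp_all
  · refine ⟨l, rfl, Prod.ext h0 (Finset.ext fun i => ?_)⟩
    have := h i
    simp only [reduceCtorEq, if_false, add_zero, Sum.inr.injEq] at this
    rw [mem_singleton, eq_comm (a := i)]
    split_ifs at this <;> simp_all

theorem eq_oddDiag_of_fieldWeight_eq_zero {f : Ind n → DPS F n}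
    (hf : ∀ s a, f s a ≠ 0 → a.1 = 0 ∧ ∀ i, fieldWeight i s a = 0) :
    f = oddDiag fun l => f (Sum.inr l) (0, {l}) := by
  funext s
  refine Finsupp.ext fun a => ?_
  by_contra hne
  by_cases h : f s a = 0
  · rcases s with l | l
    · exact hne h
    · rw [h, oddDiag, Finsupp.smul_apply, var, Finsupp.single_apply] at hne
      split_ifs at hne with ha
      · rw [ha, h, zero_smul] at hne
        exact hne rfl
      · simp at hne
  · obtain ⟨l, rfl, rfl⟩ :=
      exists_eq_singleton_of_fieldWeight_eq_zero (hf s a h).1 (hf s a h).2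
    simp [oddDiag, var] at hne

theorem exists_card_eq_three_mem (hn : 3 ≤ n) (i : Fin n) :
    ∃ u : Finset (Fin n), #u = 3 ∧ i ∈ u := by
  obtain ⟨u, hu, -, hcard⟩ := exists_subsuperset_card_eq (subset_univ {i})
    (n := 3) (by simp) (by simpa using hn)
  exact ⟨u, hcard, singleton_subset_iff.1 hu⟩

variable {p : ℕ} [CharP F p]

theorem eq_zero_of_intCast_eq_zero {m : ℤ} (h : (m : F) = 0) (hm : |m| < p) : m = 0 :=
  Int.eq_zero_of_abs_lt_dvd ((CharP.intCast_eq_zero_iff F p m).1 h) hm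

theorem two_ne_zero_of_lt (hp : 2 < p) : (2 : F) ≠ 0 := fun h =>
  two_ne_zero (eq_zero_of_intCast_eq_zero (p := p) (m := 2) (by exact_mod_cast h) (by simpa))

theorem abs_fieldWeight_le (i : Fin n) (s : Ind n) {a : Mono n} (h0 : a.1 = 0) :
    |fieldWeight i s a| ≤ 2 := by
  rw [abs_le, fieldWeight, monoWeight, h0]
  constructor <;> split_ifs <;> simp_all

theorem apply_eq_zero_of_sum_eq_on_triples (hp : 2 < p) {c : Fin n → F} {u : Finset (Fin n)}
    (hu : #u = 3) (h : ∀ l ∈ u, c l = ∑ j ∈ u, c j) {l : Fin n} (hl : l ∈ u) : c l = 0 := by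
  have hsum : ∑ j ∈ u, c j = 3 * ∑ j ∈ u, c j := by
    conv_lhs => rw [sum_congr rfl h, sum_const, hu, nsmul_eq_mul, Nat.cast_ofNat]
  have htwo : 2 * ∑ j ∈ u, c j = 0 := by linear_combination -hsum
  rw [h l hl, (mul_eq_zero.1 htwo).resolve_left (two_ne_zero_of_lt hp)]

variable [Fact p.Prime] {t : Fin n → ℕ}

theorem eq_zero_of_hamiltonian_lie_eq_zero (hp : 2 < p) (hn : 3 ≤ n) (ht : ∀ i, 1 ≤ t i)
    {V : wittEven F p t} (hV : ∀ x : hoEven F p t, ⁅x, V⁆ = 0) : V = 0 := by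
  have pd_eq_zero : ∀ i s, pd F n (Sum.inl i) (coeff V s) = 0 := fun i s => by
    rw [← neg_eq_zero, ← coeff_lie_hamiltonian_var, hV, map_zero, Pi.zero_apply]
  have apply_ne_zero : ∀ s a, coeff V s a ≠ 0 → a.1 = 0 ∧ ∀ i, fieldWeight i s a = 0 := by
    intro s a ha
    have h0 : a.1 = 0 := by
      by_contra h
      obtain ⟨i, hi⟩ := Function.ne_iff.1 h
      rw [apply_eq_pd_even_apply _ hi, pd_eq_zero] at ha
      exact ha rfl
    refine ⟨h0, fun i => eq_zero_of_intCast_eq_zero (F := F) (p := p) ?_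
      ((abs_fieldWeight_le i s h0).trans_lt (mod_cast hp))⟩
    have := coeff_lie_hamiltonian_varMul_self ht i V s a
    rw [hV, map_zero] at this
    exact (mul_eq_zero.1 this.symm).resolve_right ha
  have hdiag := eq_oddDiag_of_fieldWeight_eq_zero apply_ne_zero
  set c : Fin n → F := fun l => coeff V (Sum.inr l) (0, {l})
  have hc_zero : c = 0 := funext fun i => by
    obtain ⟨u, hu, hi⟩ := exists_card_eq_three_mem hn i
    have hodd : #u ≡ 1 [MOD 2] := by rw [hu]; rfl
    refine apply_eq_zero_of_sum_eq_on_triples hp hu (fun l hl => ?_) hi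
    have h := coeff_lie_hamiltonian
      (single_mem_oddTrunc (isOddMono_zero (p := p) (t := t) hodd) 1) V (Sum.inl l)
    rw [hV, map_zero, Pi.zero_apply, hdiag, lie_single_oddDiag hodd, eq_comm, smul_eq_zero] at h
    exact sub_eq_zero.1 (h.resolve_right (hc_single_inl_ne_zero hodd hl))
  refine coeff_injective ?_
  rw [hdiag, hc_zero, map_zero]
  funext s
  rcases s with _ | _ <;> simp [oddDiag]

end Centralizer

section Translations

variable {F : Type*} [Field F] {p : ℕ} [Fact p.Prime] [CharP F p] {n : ℕ} {t : Fin n → ℕ}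

theorem coe_toEnd_pow_apply (x : hoEven F p t) (m : ℕ) (y : hoEven F p t) :
    (((LieModule.toEnd F (hoEven F p t) (hoEven F p t) x ^ m) y : hoEven F p t) :
      wittEven F p t) = (LieModule.toEnd F (hoEven F p t) (wittEven F p t) x ^ m) y := by
  induction m with
  | zero => rfl
  | succ m ih =>
    rw [pow_succ', pow_succ', Module.End.mul_apply, Module.End.mul_apply, ← ih]
    rfl

theorem coeff_toEnd_hamiltonian_var_pow_apply (i : Fin n) (m : ℕ) (V : wittEven F p t)
    (s : Ind n) (a : Mono n) :
    coeff ((LieModule.toEnd F (hoEven F p t) (wittEven F p t)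
      (hamiltonian (var (Sum.inr i))) ^ m) V) s a =
        (-1) ^ m * coeff V s (a.1 + Pi.single i m, a.2) := by
  suffices coeff ((LieModule.toEnd F (hoEven F p t) (wittEven F p t)
      (hamiltonian (var (Sum.inr i))) ^ m) V) s =
        (-1 : F) ^ m • (pd F n (Sum.inl i) ^ m) (coeff V s) by
    rw [this, Finsupp.smul_apply, pd_even_pow_apply, smul_eq_mul]
  induction m with
  | zero => simp
  | succ m ih =>
    rw [pow_succ', Module.End.mul_apply, LieModule.toEnd_apply_apply, coeff_lie_hamiltonian_var,
      ih, map_smul, pow_succ' (pd F n _), Module.End.mul_apply, pow_succ, mul_smul, neg_one_smul,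
      smul_neg]

theorem toEnd_hamiltonian_var_pow_eq_zero (i : Fin n) :
    LieModule.toEnd F (hoEven F p t) (wittEven F p t) (hamiltonian (var (Sum.inr i))) ^ p ^ t i =
      0 := by
  refine LinearMap.ext fun V => eq_zero_of_coeff_eq_zero fun s a => ?_
  rw [coeff_toEnd_hamiltonian_var_pow_apply]
  by_contra h
  have hle : (a.1 + Pi.single i (p ^ t i) : Fin n → ℕ) i ≤ p ^ t i - 1 :=
    (Finsupp.mem_supported F _).1 (coeff_mem V s).1
      (Finsupp.mem_support_iff.2 (right_ne_zero_of_mul h)) i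
  have hpos : 0 < p ^ t i := pow_pos (Fact.out : p.Prime).pos _
  simp only [Pi.add_apply, Pi.single_eq_same] at hle
  omega

theorem toEnd_hoEven_hamiltonian_var_pow_eq_zero (i : Fin n) :
    LieModule.toEnd F (hoEven F p t) (hoEven F p t) (hamiltonian (var (Sum.inr i))) ^ p ^ t i =
      0 := by
  refine LinearMap.ext fun y => Subtype.ext ?_
  rw [coe_toEnd_pow_apply, toEnd_hamiltonian_var_pow_eq_zero]
  rfl

variable {D : LieDerivation F (hoEven F p t) (wittEven F p t)}

theorem coeff_derivation_hamiltonian_var_top_eq_zero (hp : 2 < p) (hn : 3 ≤ n)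
    (ht : ∀ i, 1 ≤ t i) {i : Fin n} (s : Ind n) {a : Mono n} (ha : a.1 i = p ^ t i - 1) :
    coeff (D (hamiltonian (var (Sum.inr i)))) s a = 0 := by
  have hzero := eq_zero_of_hamiltonian_lie_eq_zero hp hn ht
    (lie_toEnd_pow_derivation_eq_zero p (t i) D _ (toEnd_hoEven_hamiltonian_var_pow_eq_zero i)
      (toEnd_hamiltonian_var_pow_eq_zero i))
  have h := coeff_toEnd_hamiltonian_var_pow_apply i (p ^ t i - 1)
    (D (hamiltonian (var (Sum.inr i)))) s (a.1 - Pi.single i (a.1 i), a.2)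
  have hadd : a.1 - Pi.single i (a.1 i) + Pi.single i (a.1 i) = a.1 := by
    refine tsub_add_cancel_of_le fun j => ?_
    rcases eq_or_ne j i with rfl | hj <;> simp [*]
  rw [hzero, map_zero, ← ha, hadd] at h
  exact (mul_eq_zero.1 h.symm).resolve_left (pow_ne_zero _ (neg_ne_zero.2 one_ne_zero))

theorem pd_coeff_derivation_hamiltonian_var (i j : Fin n) (s : Ind n) :
    pd F n (Sum.inl i) (coeff (D (hamiltonian (var (Sum.inr j)))) s) =
      pd F n (Sum.inl j) (coeff (D (hamiltonian (var (Sum.inr i)))) s) := by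
  have h := congrArg (fun V => coeff V s)
    (D.apply_lie_eq_sub (hamiltonian (var (Sum.inr i))) (hamiltonian (var (Sum.inr j))))
  rw [hamiltonian_lie (var_odd_mem_oddTrunc i) (var_odd_mem_oddTrunc j), TH_var, pd_var,
    if_neg (by simp), neg_zero, map_zero, map_zero, map_sub, Pi.sub_apply,
    coeff_lie_hamiltonian_var, coeff_lie_hamiltonian_var, map_zero, Pi.zero_apply] at h
  exact neg_injective (sub_eq_zero.1 h.symm)

theorem exists_sub_adW_hamiltonian_var_eq_zero (hp : 2 < p) (hn : 3 ≤ n) (ht : ∀ i, 1 ≤ t i)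
    {d : ℤ} (hD : D ∈ derDeg F p t d) : ∃ E ∈ wittEvenDeg F p t d,
      ∀ i, (D - adW F p t E) (hamiltonian (var (Sum.inr i))) = 0 := by
  choose G pd_G G_zero using fun s => exists_antiderivative
    (fun i => coeff (D (hamiltonian (var (Sum.inr i)))) s)
    (fun i j => pd_coeff_derivation_hamiltonian_var i j s)
  have isWittMono_G : ∀ s a, G s a ≠ 0 → IsWittMono p t d s a := by
    intro s a ha
    have lowered_ne_zero : ∀ i, a.1 i ≠ 0 →
        coeff (D (hamiltonian (var (Sum.inr i)))) s (a.1 - Pi.single i 1, a.2) ≠ 0 := by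
      intro i hi
      rwa [apply_eq_pd_even_apply _ hi, pd_G] at ha
    have isWittMono_lowered := fun i hi => isWittMono_of_coeff_apply_ne_zero hD
      (isOddMono_zero (u := {i}) rfl) (lowered_ne_zero i hi)
    refine ⟨fun i => ?_, ?_⟩
    · by_contra! hlt
      have hi : a.1 i ≠ 0 := by omega
      have hle := (isWittMono_lowered i hi).1 i
      refine lowered_ne_zero i hi (coeff_derivation_hamiltonian_var_top_eq_zero hp hn ht s ?_)
      simp only [Pi.sub_apply, Pi.single_eq_same] at hle ⊢
      omega
    · obtain ⟨i, hi⟩ := Function.ne_iff.1 (mt (G_zero s a) ha)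
      obtain ⟨-, hpar, hdeg⟩ := isWittMono_lowered i hi
      refine ⟨hpar, ?_⟩
      have := sum_sub_single_add_one hi
      simp only [monoDegree, Pi.zero_apply, sum_const_zero, card_singleton] at hdeg ⊢
      omega
  obtain ⟨E, hE, coeff_E⟩ := exists_mem_wittEvenDeg_coeff_eq isWittMono_G
  refine ⟨E, hE, fun i => coeff_injective (funext fun s => ?_)⟩
  rw [sub_adW_apply, map_add, Pi.add_apply, coeff_lie_hamiltonian_var, coeff_E, pd_G,
    add_neg_cancel, map_zero, Pi.zero_apply]

end Translations

section Torus

theorem lie_derivation_eq_zero_of_eigenvector {R L M : Type*} [CommRing R]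
    [LieRing L] [LieAlgebra R L] [AddCommGroup M] [Module R M] [LieRingModule L M] [LieModule R L M]
    (D : LieDerivation R L M) {h x : L} {c : R} (hx : ⁅h, x⁆ = c • x) (hD : ⁅h, D h⁆ = 0)
    (hss : ∀ m : M, ⁅h, ⁅h, m⁆ - c • m⁆ = c • (⁅h, m⁆ - c • m) → ⁅h, m⁆ = c • m) :
    ⁅x, D h⁆ = 0 := by
  have hlie : ⁅x, D h⁆ = ⁅h, D x⁆ - c • D x := by
    rw [← map_smul, ← hx, LieDerivation.apply_lie_eq_sub, sub_sub_cancel]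
  rw [hlie, sub_eq_zero]
  refine hss _ ?_
  rw [← hlie, leibniz_lie, hx, hD, lie_zero, add_zero, smul_lie]

theorem exists_common_quotient {ι F : Type*} [Field F] {w g : ι → F}
    (h : ∀ i j, w i * g j = w j * g i) :
    ∃ e : F, (∀ i j, w i * (g j + w j * e) = 0) ∧ (e ≠ 0 → ∃ i, g i ≠ 0) := by
  by_cases hw : ∃ k, w k ≠ 0
  · obtain ⟨k, hk⟩ := hw
    refine ⟨-(g k / w k), fun i j => ?_, fun he => ⟨k, fun hg => he (by simp [hg])⟩⟩
    have hj : g j + w j * -(g k / w k) = 0 := by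
      field_simp
      linear_combination h k j
    rw [hj, mul_zero]
  · push Not at hw
    exact ⟨0, fun i j => by simp [hw], fun he => absurd rfl he⟩

variable {F : Type*} [Field F] {p : ℕ} [Fact p.Prime] [CharP F p] {n : ℕ} {t : Fin n → ℕ}
  {D : LieDerivation F (hoEven F p t) (wittEven F p t)}

theorem pd_coeff_derivation_hamiltonian
    (hD : ∀ i, D (hamiltonian (var (Sum.inr i))) = 0) {b : DPS F n} (hb : b ∈ oddTrunc F p t)
    (i : Fin n) (s : Ind n) :
    pd F n (Sum.inl i) (coeff (D (hamiltonian b)) s) =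
      coeff (D (hamiltonian (pd F n (Sum.inl i) b))) s := by
  have h := congrArg (fun V => coeff V s)
    (D.apply_lie_eq_sub (hamiltonian (var (Sum.inr i))) (hamiltonian b))
  rw [hamiltonian_lie (var_odd_mem_oddTrunc i) hb, TH_var, hD, lie_zero, sub_zero,
    coeff_lie_hamiltonian_var, map_neg, map_neg, map_neg, Pi.neg_apply] at h
  exact (neg_injective h).symm

theorem hamiltonian_varMul_self_lie (ht : ∀ i, 1 ≤ t i) (k : Fin n) {b : Mono n}
    (hb : IsOddMono p t b) :
    ⁅(hamiltonian (varMul F k k) : hoEven F p t),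
      (hamiltonian (Finsupp.single b 1) : hoEven F p t)⁆ =
        (monoWeight k b : F) • hamiltonian (Finsupp.single b 1) := by
  rw [hamiltonian_lie (varMul_mem_oddTrunc ht k k) (single_mem_oddTrunc hb 1),
    TH_varMul_self_single, ← map_smul, Finsupp.smul_single, smul_eq_mul]

theorem fieldWeight_mul_coeff_derivation_hamiltonian (ht : ∀ i, 1 ≤ t i) {k : Fin n}
    (hD : D (hamiltonian (varMul F k k)) = 0) {b : Mono n} (hb : IsOddMono p t b) (s : Ind n)
    (a : Mono n) :
    fieldWeight k s a * coeff (D (hamiltonian (Finsupp.single b 1))) s a =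
      monoWeight k b * coeff (D (hamiltonian (Finsupp.single b 1))) s a := by
  have h := congrArg (fun V => coeff V s a)
    (D.apply_lie_eq_sub (hamiltonian (varMul F k k)) (hamiltonian (Finsupp.single b 1)))
  rw [hamiltonian_varMul_self_lie ht k hb, hD, lie_zero, sub_zero,
    coeff_lie_hamiltonian_varMul_self ht, map_smul, map_smul] at h
  exact h.symm

theorem derivation_hamiltonian_varMul_self_eq_zero (hp : 2 < p) (hn : 3 ≤ n)
    (ht : ∀ i, 1 ≤ t i) {k : Fin n}
    (hk : ⁅(hamiltonian (varMul F k k) : hoEven F p t), D (hamiltonian (varMul F k k))⁆ = 0) :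
    D (hamiltonian (varMul F k k)) = 0 := by
  let lieRight : hoEven F p t →ₗ[F] wittEven F p t :=
    { toFun x := ⁅x, D (hamiltonian (varMul F k k))⁆
      map_add' _ _ := add_lie _ _ _
      map_smul' _ _ := smul_lie _ _ _ }
  refine eq_zero_of_hamiltonian_lie_eq_zero hp hn ht (LinearMap.congr_fun (f := lieRight)
    (linearMap_eq_zero_of_hamiltonian _ fun b hb => ?_))
  refine lie_derivation_eq_zero_of_eigenvector D (hamiltonian_varMul_self_lie ht k hb) hk
    fun V hV => sub_eq_zero.1 (eq_zero_of_coeff_eq_zero fun s a => ?_)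
  have h := congrArg (fun W => coeff W s a) hV
  simp only [map_sub, map_smul, lie_sub, lie_smul, Pi.sub_apply, Pi.smul_apply, Finsupp.sub_apply,
    Finsupp.smul_apply, smul_eq_mul, coeff_lie_hamiltonian_varMul_self ht] at h ⊢
  have hsq : (fieldWeight k s a - monoWeight k b : F) ^ 2 * coeff V s a = 0 := by
    linear_combination h
  rcases mul_eq_zero.1 hsq with h0 | h0
  · linear_combination coeff V s a * (pow_eq_zero_iff two_ne_zero).1 h0
  · rw [h0, mul_zero, mul_zero, sub_zero]

theorem fieldWeight_mul_coeff_derivation_varMul_self (ht : ∀ i, 1 ≤ t i) (i j : Fin n)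
    (s : Ind n) (a : Mono n) :
    (fieldWeight i s a : F) * coeff (D (hamiltonian (varMul F j j))) s a =
      fieldWeight j s a * coeff (D (hamiltonian (varMul F i i))) s a := by
  have hlie : ⁅(hamiltonian (varMul F i i) : hoEven F p t),
      (hamiltonian (varMul F j j) : hoEven F p t)⁆ = 0 := by
    have hj : IsOddMono p t (Pi.single j 1, {j}) := isOddMono_single ht j rfl
    refine (hamiltonian_varMul_self_lie ht i hj).trans (smul_eq_zero_of_left ?_ _)
    rcases eq_or_ne i j with rfl | hij <;> simp [monoWeight, *]
  have h := congrArg (fun V => coeff V s a)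
    (D.apply_lie_eq_sub (hamiltonian (varMul F i i)) (hamiltonian (varMul F j j)))
  rw [hlie, map_zero, map_zero, map_sub, Pi.sub_apply, Finsupp.sub_apply,
    coeff_lie_hamiltonian_varMul_self ht, coeff_lie_hamiltonian_varMul_self ht] at h
  exact sub_eq_zero.1 h.symm

theorem exists_fieldWeight_mul_add_eq_zero (ht : ∀ i, 1 ≤ t i) {d : ℤ} (hD : D ∈ derDeg F p t d) :
    ∃ E ∈ wittEvenDeg F p t d, ∀ s a,
      (∀ i j, (fieldWeight i s a : F) *
        (coeff (D (hamiltonian (varMul F j j))) s a + fieldWeight j s a * coeff E s a) = 0) ∧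
      (coeff E s a ≠ 0 → ∃ i, coeff (D (hamiltonian (varMul F i i))) s a ≠ 0) := by
  choose e mul_add_eq_zero exists_ne_zero using fun s a => exists_common_quotient
    fun i j => fieldWeight_mul_coeff_derivation_varMul_self (D := D) ht i j s a
  let f : Ind n → DPS F n := fun s => Finsupp.onFinset
    (univ.biUnion fun i => (coeff (D (hamiltonian (varMul F i i))) s).support) (e s) fun a ha => by
      obtain ⟨i, hi⟩ := exists_ne_zero s a ha
      exact mem_biUnion.2 ⟨i, mem_univ i, Finsupp.mem_support_iff.2 hi⟩
  obtain ⟨E, hE, coeff_E⟩ := exists_mem_wittEvenDeg_coeff_eq (d := d) (f := f) fun s a ha => by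
    obtain ⟨i, hi⟩ := exists_ne_zero s a ha
    simpa [monoDegree] using
      isWittMono_of_coeff_apply_ne_zero hD (isOddMono_single ht i (u := {i}) rfl) hi
  refine ⟨E, hE, fun s a => ?_⟩
  rw [coeff_E]
  exact ⟨mul_add_eq_zero s a, exists_ne_zero s a⟩

theorem exists_sub_adW_hamiltonian_varMul_self_eq_zero (hp : 2 < p) (hn : 3 ≤ n)
    (ht : ∀ i, 1 ≤ t i) {d : ℤ} (hD : D ∈ derDeg F p t d)
    (hvar : ∀ i, D (hamiltonian (var (Sum.inr i))) = 0) :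
    ∃ E ∈ wittEvenDeg F p t d,
      (∀ i, (D - adW F p t E) (hamiltonian (var (Sum.inr i))) = 0) ∧
      ∀ i, (D - adW F p t E) (hamiltonian (varMul F i i)) = 0 := by
  obtain ⟨E, hE, h⟩ := exists_fieldWeight_mul_add_eq_zero ht hD
  have pd_coeff_E : ∀ i s, pd F n (Sum.inl i) (coeff E s) = 0 := fun i s => Finsupp.ext fun a => by
    rw [pd_even_apply]
    by_contra hne
    obtain ⟨k, hk⟩ := (h s _).2 hne
    rw [← pd_even_apply, pd_coeff_derivation_hamiltonian hvar (varMul_mem_oddTrunc ht k k),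
      pd_varMul] at hk
    split_ifs at hk <;> simp_all
  refine ⟨E, hE, fun i => coeff_injective (funext fun s => ?_), fun k =>
    derivation_hamiltonian_varMul_self_eq_zero hp hn ht (eq_zero_of_coeff_eq_zero fun s a => ?_)⟩
  · rw [sub_adW_apply, hvar, zero_add, coeff_lie_hamiltonian_var, pd_coeff_E, neg_zero, map_zero,
      Pi.zero_apply]
  · rw [coeff_lie_hamiltonian_varMul_self ht, sub_adW_apply, map_add, Pi.add_apply,
      Finsupp.add_apply, coeff_lie_hamiltonian_varMul_self ht]
    exact (h s a).1 k k

end Torus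

section Weights

variable {n : ℕ}

theorem par_le_one (s : Ind n) : par s ≤ 1 := by
  rcases s with _ | _ <;> simp [par]

theorem neg_par_le_fieldWeight (i : Fin n) (s : Ind n) {a : Mono n} (h : a.1 = 0) :
    -(par s : ℤ) ≤ fieldWeight i s a := by
  rcases s with _ | _ <;> simp only [fieldWeight, monoWeight, par, h] <;> split_ifs <;> simp_all

theorem fieldWeight_le (i : Fin n) (s : Ind n) {a : Mono n} (h : a.1 = 0) :
    fieldWeight i s a ≤ 2 - par s := by
  rcases s with _ | _ <;> simp only [fieldWeight, monoWeight, par, h] <;> split_ifs <;> simp_all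

theorem sum_fieldWeight (s : Ind n) (a : Mono n) :
    ∑ i, fieldWeight i s a = #a.2 - ∑ i, (a.1 i : ℤ) + 1 - 2 * par s := by
  rcases s with l | l <;>
    simp only [fieldWeight, monoWeight, par, sum_add_distrib, sum_sub_distrib, sum_ite_mem,
      sum_ite_eq, univ_inter, mem_univ, if_true, sum_const, nsmul_eq_mul, mul_one,
      Sum.inl.injEq, Sum.inr.injEq, reduceCtorEq, if_false, mul_zero] <;>
    ring_nf

theorem eq_sub_or_sub_sub_le {p σ w ε α : ℤ} (hp : 5 ≤ p) (hw : -1 ≤ w) (hwσ : w ≤ 2 - σ)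
    (hε : 0 ≤ ε) (hε' : ε ≤ 1) (hα : 0 ≤ α) (h : p ∣ w - (ε - α)) :
    w = ε - α ∨ w - ε - α ≤ -1 - 2 * σ := by
  obtain ⟨k, hk⟩ := h
  rcases lt_trichotomy k 0 with hneg | rfl | hpos
  · have : p * k ≤ -p := by nlinarith
    omega
  · omega
  · have : p ≤ p * k := by nlinarith
    omega

/-- Matching torus weights modulo `p` and matching degrees force the weights to agree as integers,
since a discrepancy of at least `p` would cost too much degree. -/
theorem fieldWeight_eq_monoWeight_of_modEq {p : ℕ} (hp : 5 ≤ p) {a b : Mono n} {s : Ind n} {d : ℤ}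
    (hd : 0 ≤ d) (ha : a.1 = 0) (hw : ∀ i, monoWeight i b ≡ fieldWeight i s a [ZMOD p])
    (hdeg : (monoDegree a : ℤ) + 1 = monoDegree b + d) (hpa : #a.2 ≡ par s [MOD 2])
    (hpb : #b.2 ≡ 1 [MOD 2]) :
    d = 0 ∧ ∑ i, b.1 i = par s ∧ ∀ i, fieldWeight i s a = monoWeight i b := by
  let defect : Fin n → ℤ := fun i =>
    fieldWeight i s a - (if i ∈ b.2 then 1 else 0) - b.1 i
  have sum_defect : ∑ i, defect i = d - 2 * par s := by
    simp only [monoDegree, ha, Pi.zero_apply, sum_const_zero, zero_add] at hdeg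
    push_cast at hdeg
    simp only [defect, sum_sub_distrib, sum_fieldWeight, ha]
    simp only [sum_ite_mem, univ_inter, sum_const, nsmul_eq_mul, mul_one, Pi.zero_apply,
      Nat.cast_zero, mul_zero]
    linarith
  have eq_or_defect_le : ∀ i, fieldWeight i s a = monoWeight i b ∨ defect i ≤ -1 - 2 * par s :=
    fun i => eq_sub_or_sub_sub_le (p := p) (mod_cast hp)
      ((neg_par_le_fieldWeight i s ha).trans' (by have := par_le_one s; omega))
      (fieldWeight_le i s ha) (by split_ifs <;> simp) (by split_ifs <;> simp) (by simp) (hw i).dvd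
  have defect_nonpos : ∀ i, defect i ≤ 0 := fun i => by
    rcases eq_or_defect_le i with h | h
    · simp only [defect, h, monoWeight]
      omega
    · omega
  have weight_eq : ∀ i, fieldWeight i s a = monoWeight i b := fun i =>
    (eq_or_defect_le i).resolve_right fun hi => by
      have := add_sum_erase univ defect (mem_univ i)
      have := sum_nonpos fun j (_ : j ∈ univ.erase i) => defect_nonpos j
      omega
  have sum_eq : 2 * ∑ i, (b.1 i : ℤ) = 2 * par s - d := by
    rw [mul_sum, ← neg_inj, ← sum_neg_distrib, neg_sub, ← sum_defect]
    refine sum_congr rfl fun i _ => ?_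
    simp only [defect, weight_eq, monoWeight]
    ring
  have := par_le_one s
  have : 0 ≤ ∑ i, (b.1 i : ℤ) := sum_nonneg fun i _ => by positivity
  simp only [monoDegree, ha, Pi.zero_apply, sum_const_zero, zero_add, Nat.ModEq] at hdeg hpa hpb
  push_cast at hdeg
  have hd0 : d = 0 := by omega
  refine ⟨hd0, ?_, weight_eq⟩
  rw [← Nat.cast_inj (R := ℤ)]
  push_cast
  omega

end Weights

section Vanishing

variable {F : Type*} [Field F] {p : ℕ} [Fact p.Prime] [CharP F p] {n : ℕ} {t : Fin n → ℕ}
  {D : LieDerivation F (hoEven F p t) (wittEven F p t)} {d : ℤ}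

theorem even_part_eq_zero_of_coeff_derivation_ne_zero
    (hvar : ∀ i, D (hamiltonian (var (Sum.inr i))) = 0) {b : Mono n} (hb : IsOddMono p t b)
    (hlower : ∀ i, b.1 i ≠ 0 → D (hamiltonian (Finsupp.single (b.1 - Pi.single i 1, b.2) 1)) = 0)
    {s : Ind n} {a : Mono n} (h : coeff (D (hamiltonian (Finsupp.single b 1))) s a ≠ 0) :
    a.1 = 0 := by
  by_contra h0
  obtain ⟨i, hi⟩ := Function.ne_iff.1 h0
  rw [apply_eq_pd_even_apply _ hi,
    pd_coeff_derivation_hamiltonian hvar (single_mem_oddTrunc hb 1), pd_even_single] at h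
  split_ifs at h with hbi
  · simp at h
  · simp [hlower i hbi] at h

theorem weights_of_coeff_derivation_ne_zero (hp : 5 ≤ p) (ht : ∀ i, 1 ≤ t i) (hd : 0 ≤ d)
    (hD : D ∈ derDeg F p t d) (hvar : ∀ i, D (hamiltonian (var (Sum.inr i))) = 0)
    (htorus : ∀ i, D (hamiltonian (varMul F i i)) = 0) {b : Mono n} (hb : IsOddMono p t b)
    (hlower : ∀ i, b.1 i ≠ 0 → D (hamiltonian (Finsupp.single (b.1 - Pi.single i 1, b.2) 1)) = 0)
    {s : Ind n} {a : Mono n} (h : coeff (D (hamiltonian (Finsupp.single b 1))) s a ≠ 0) :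
    a.1 = 0 ∧ d = 0 ∧ ∑ i, b.1 i = par s ∧ ∀ i, fieldWeight i s a = monoWeight i b := by
  have ha := even_part_eq_zero_of_coeff_derivation_ne_zero hvar hb hlower h
  obtain ⟨-, hpar, hdeg⟩ := isWittMono_of_coeff_apply_ne_zero hD hb h
  have hmod : ∀ i, monoWeight i b ≡ fieldWeight i s a [ZMOD p] := fun i =>
    ((CharP.intCast_eq_intCast F p).1 (mul_right_cancel₀ h
      (fieldWeight_mul_coeff_derivation_hamiltonian ht (htorus i) hb s a))).symm
  exact ⟨ha, fieldWeight_eq_monoWeight_of_modEq hp hd ha hmod (by omega) hpar hb.2⟩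

theorem derivation_hamiltonian_eq_zero_of_lower (hp : 5 ≤ p) (ht : ∀ i, 1 ≤ t i) (hd : 0 ≤ d)
    (hD : D ∈ derDeg F p t d) (hvar : ∀ i, D (hamiltonian (var (Sum.inr i))) = 0)
    (htorus : ∀ i, D (hamiltonian (varMul F i i)) = 0) {b : Mono n} (hb : IsOddMono p t b)
    (hlower : ∀ i, b.1 i ≠ 0 → D (hamiltonian (Finsupp.single (b.1 - Pi.single i 1, b.2) 1)) = 0)
    (hsum : d = 0 → 2 ≤ ∑ i, b.1 i) : D (hamiltonian (Finsupp.single b 1)) = 0 := by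
  refine eq_zero_of_coeff_eq_zero fun s a => ?_
  by_contra h
  obtain ⟨-, hd0, hs, -⟩ :=
    weights_of_coeff_derivation_ne_zero hp ht hd hD hvar htorus hb hlower h
  have := hsum hd0
  have := par_le_one s
  omega

theorem derivation_eq_zero_of_hamiltonian_low (hp : 5 ≤ p) (ht : ∀ i, 1 ≤ t i) (hd : 0 ≤ d)
    (hD : D ∈ derDeg F p t d) (hvar : ∀ i, D (hamiltonian (var (Sum.inr i))) = 0)
    (htorus : ∀ i, D (hamiltonian (varMul F i i)) = 0)
    (hlow : d = 0 → ∀ b : Mono n, IsOddMono p t b → ∑ i, b.1 i ≤ 1 →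
      D (hamiltonian (Finsupp.single b 1)) = 0) : D = 0 := by
  suffices h : (D : hoEven F p t →ₗ[F] wittEven F p t) = 0 from
    LieDerivation.ext (LinearMap.congr_fun h)
  refine linearMap_eq_zero_of_hamiltonian _ fun b hb => ?_
  induction hm : ∑ i, b.1 i using Nat.strong_induction_on generalizing b with
  | _ m ih =>
    by_cases hlow' : d = 0 ∧ m ≤ 1
    · exact hlow hlow'.1 b hb (hm.trans_le hlow'.2)
    · refine derivation_hamiltonian_eq_zero_of_lower hp ht hd hD hvar htorus hb
        (fun i hi => ih _ ?_ _ (hb.sub_single i) rfl) (by omega)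
      rw [← hm, ← sum_sub_single_add_one hi]
      exact Nat.lt_succ_self _

theorem derivation_hamiltonian_TH_eq_zero {a b : DPS F n} (ha : a ∈ oddTrunc F p t)
    (hb : b ∈ oddTrunc F p t) (hDa : D (hamiltonian a) = 0) (hDb : D (hamiltonian b) = 0) :
    D (hamiltonian (TH F n a b)) = 0 := by
  rw [← hamiltonian_lie ha hb, LieDerivation.apply_lie_eq_sub, hDa, hDb, lie_zero, lie_zero,
    sub_zero]

theorem derivation_hamiltonian_single_eq_zero {a b m : Mono n} {c : F} (ha : IsOddMono p t a)
    (hb : IsOddMono p t b) (hc : c ≠ 0)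
    (h : TH F n (Finsupp.single a 1) (Finsupp.single b 1) = Finsupp.single m c)
    (hDa : D (hamiltonian (Finsupp.single a 1)) = 0)
    (hDb : D (hamiltonian (Finsupp.single b 1)) = 0) :
    D (hamiltonian (Finsupp.single m 1)) = 0 := by
  have := derivation_hamiltonian_TH_eq_zero (single_mem_oddTrunc ha 1) (single_mem_oddTrunc hb 1)
    hDa hDb
  rw [h, ← mul_one c, ← smul_eq_mul, ← Finsupp.smul_single, map_smul, map_smul] at this
  exact (smul_eq_zero.1 this).resolve_left hc

end Vanishing

section DegreeZero

variable {F : Type*} [Field F] {n : ℕ}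

theorem TH_varMul_var_odd (i j l : Fin n) :
    TH F n (varMul F i j) (var (Sum.inr l)) = if l = i then var (Sum.inr j) else 0 := by
  have h0 : pd F n (Sum.inl j) (var (Sum.inr l)) = 0 := by rw [pd_var, if_neg (by simp)]
  rw [TH_varMul, h0, map_zero, sub_zero, pd_var]
  by_cases h : l = i
  · rw [if_pos h, if_pos (by rw [h]), mul_one']
  · rw [if_neg h, if_neg (by simpa using Ne.symm h), map_zero]

theorem TH_varMul_varMul (i j k : Fin n) :
    TH F n (varMul F i j) (varMul F j k) = (if k = i then varMul F j j else 0) - varMul F i k := by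
  have mul_var_odd : mul F n (var (Sum.inl i)) (var (Sum.inr k)) = varMul F i k := by
    simp [var, varMul, mul_single, mulCoeff, wedgeSign]
  have odd_mul_var : mul F n (var (Sum.inr j)) (var (Sum.inl j)) = varMul F j j := by
    simp [var, varMul, mul_single, mulCoeff, wedgeSign]
  rw [TH_varMul, pd_varMul, pd_varMul, if_pos rfl, mul_var_odd]
  by_cases h : k = i
  · simp [h, odd_mul_var]
  · simp [h, Ne.symm h]

theorem TH_varMul_odd_single_eq_zero {i j : Fin n} (hij : i ≠ j) {u : Finset (Fin n)}
    (hj : j ∈ u) : TH F n (varMul F i j) (Finsupp.single (0, u) 1) = 0 := by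
  rw [TH_varMul, odd_mul_pd_odd_single, pd_even_single,
    wedgeSign_eq_zero (mem_singleton_self j) (mem_erase.2 ⟨hij.symm, hj⟩)]
  simp

theorem eq_of_fieldWeight_eq_monoWeight_varMul {i j : Fin n} (hij : i ≠ j) {s : Ind n}
    {a : Mono n} (hs : par s = 1) (ha : a.1 = 0)
    (h : ∀ k, fieldWeight k s a = monoWeight k (Pi.single i 1, {j})) :
    s = Sum.inr i ∧ a = (0, {j}) := by
  rcases s with l | l
  · simp [par] at hs
  have hk : ∀ k, (if k ∈ a.2 then (1 : ℤ) else 0) - (if k = l then 1 else 0) =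
      (if k = j then 1 else 0) - if k = i then 1 else 0 := fun k => by
    simpa [fieldWeight, monoWeight, ha, Pi.single_apply, eq_comm (a := l)] using h k
  have hl : l = i := by
    by_contra hne
    have := hk i
    simp only [hij, Ne.symm hne, if_true, if_false] at this
    split_ifs at this <;> omega
  subst hl
  refine ⟨rfl, Prod.ext ha (Finset.ext fun k => ?_)⟩
  grind [hk k]

theorem exists_eq_of_fieldWeight_eq_monoWeight_odd {u : Finset (Fin n)} {s : Ind n} {a : Mono n}
    (hs : par s = 0) (ha : a.1 = 0) (h : ∀ k, fieldWeight k s a = monoWeight k (0, u)) :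
    ∃ l ∈ u, s = Sum.inl l ∧ a = (0, u.erase l) := by
  rcases s with l | l
  swap
  · simp [par] at hs
  have hk : ∀ k, (if k ∈ a.2 then (1 : ℤ) else 0) + (if k = l then 1 else 0) =
      if k ∈ u then 1 else 0 := fun k => by
    simpa [fieldWeight, monoWeight, ha, eq_comm (a := l)] using h k
  have hl : l ∈ u ∧ l ∉ a.2 := by
    have := hk l
    rw [if_pos rfl] at this
    split_ifs at this <;> simp_all
  refine ⟨l, hl.1, rfl, Prod.ext ha (Finset.ext fun k => ?_)⟩
  have := hk k
  rw [mem_erase]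
  rcases eq_or_ne k l with rfl | hne
  · simp [hl.2]
  · split_ifs at this <;> simp_all

variable {p : ℕ} [Fact p.Prime] [CharP F p] {t : Fin n → ℕ}
  {D : LieDerivation F (hoEven F p t) (wittEven F p t)}

theorem exists_mem_wittEvenDeg_zero_coeff_eq_oddDiag (c : Fin n → F) :
    ∃ E ∈ wittEvenDeg F p t 0, coeff E = oddDiag c := by
  refine exists_mem_wittEvenDeg_coeff_eq fun s a h => ?_
  rcases s with l | l
  · exact absurd rfl h
  · have ha : a = (0, {l}) := by
      by_contra hne
      simp [oddDiag, var, Ne.symm hne] at h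
    subst ha
    exact ⟨fun _ => Nat.zero_le _, rfl, by simp [monoDegree]⟩

theorem coeff_sub_adW_hamiltonian_single {E : wittEven F p t} {c : Fin n → F}
    (hE : coeff E = oddDiag c) {b : Mono n} (hb : IsOddMono p t b) (s : Ind n) :
    coeff ((D - adW F p t E) (hamiltonian (Finsupp.single b 1))) s =
      coeff (D (hamiltonian (Finsupp.single b 1))) s +
        (Sum.elim c c s - ∑ j ∈ b.2, c j) • hc (Finsupp.single b 1) s := by
  rw [sub_adW_apply, map_add, Pi.add_apply,
    coeff_lie_hamiltonian (single_mem_oddTrunc hb 1), hE, lie_single_oddDiag hb.2]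

theorem sub_adW_hamiltonian_var_eq_zero {E : wittEven F p t} {c : Fin n → F}
    (hE : coeff E = oddDiag c) {i : Fin n} (hD : D (hamiltonian (var (Sum.inr i))) = 0) :
    (D - adW F p t E) (hamiltonian (var (Sum.inr i))) = 0 := by
  refine coeff_injective (funext fun s => ?_)
  rw [sub_adW_apply, hD, zero_add, coeff_lie_hamiltonian_var, hE, map_zero, Pi.zero_apply]
  rcases s with l | l <;> simp [oddDiag, pd_var]

theorem coeff_sub_adW_hamiltonian_varMul {E : wittEven F p t} {c : Fin n → F}
    (ht : ∀ i, 1 ≤ t i) (hE : coeff E = oddDiag c) (i j : Fin n) (s : Ind n) :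
    coeff ((D - adW F p t E) (hamiltonian (varMul F i j))) s =
      coeff (D (hamiltonian (varMul F i j))) s +
        if s = Sum.inr i then (c i - c j) • var (Sum.inr j) else 0 := by
  have h := coeff_sub_adW_hamiltonian_single (D := D) hE
    (isOddMono_single ht i (u := {j}) rfl) s
  refine h.trans (congrArg _ ?_)
  change _ • hc (varMul F i j) s = _
  rw [hc_varMul]
  rcases s with l | l
  · by_cases hl : l = j <;> simp [hl]
  · by_cases hl : l = i <;> simp [hl]

theorem exists_coeff_derivation_hamiltonian_varMul (hp : 5 ≤ p) (ht : ∀ i, 1 ≤ t i)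
    (hD : D ∈ derDeg F p t 0) (hvar : ∀ i, D (hamiltonian (var (Sum.inr i))) = 0)
    (htorus : ∀ i, D (hamiltonian (varMul F i i)) = 0) :
    ∃ q : Fin n → Fin n → F, ∀ i j s, coeff (D (hamiltonian (varMul F i j))) s =
      if s = Sum.inr i then q i j • var (Sum.inr j) else 0 := by
  refine ⟨fun i j => coeff (D (hamiltonian (varMul F i j))) (Sum.inr i) (0, {j}),
    fun i j s => Finsupp.ext fun a => ?_⟩
  rcases eq_or_ne i j with rfl | hij
  · simp [htorus]
  by_cases ha : s = Sum.inr i ∧ a = (0, {j})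
  · obtain ⟨rfl, rfl⟩ := ha
    simp [var]
  · have hzero : coeff (D (hamiltonian (varMul F i j))) s a = 0 := by
      by_contra h
      have hlower : ∀ k, (Pi.single i 1 : Fin n → ℕ) k ≠ 0 →
          D (hamiltonian (Finsupp.single (Pi.single i 1 - Pi.single k 1, {j}) 1)) = 0 := by
        intro k hk
        obtain rfl : k = i := by
          by_contra hki
          exact hk (Pi.single_eq_of_ne hki 1)
        rw [tsub_self]
        exact hvar j
      obtain ⟨ha0, -, hs, hw⟩ := weights_of_coeff_derivation_ne_zero hp ht le_rfl hD hvar htorus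
        (isOddMono_single ht i (u := {j}) rfl) hlower h
      exact ha (eq_of_fieldWeight_eq_monoWeight_varMul hij (by simpa using hs.symm) ha0 hw)
    rw [hzero]
    split_ifs with hs
    · have : (0, {j}) ≠ a := fun e => ha ⟨hs, e.symm⟩
      simp [var, Finsupp.single_eq_of_ne' this]
    · rfl

theorem varMul_cocycle (ht : ∀ i, 1 ≤ t i) (htorus : ∀ i, D (hamiltonian (varMul F i i)) = 0)
    {q : Fin n → Fin n → F} (hq : ∀ i j s, coeff (D (hamiltonian (varMul F i j))) s =
      if s = Sum.inr i then q i j • var (Sum.inr j) else 0) (i j k : Fin n) :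
    q i j + q j k = q i k := by
  rcases eq_or_ne i j with rfl | hij
  · have h := congrArg (fun f => f (0, {i})) (hq i i (Sum.inr i))
    simp only [htorus, map_zero, Pi.zero_apply, var, if_true, Finsupp.smul_single, smul_eq_mul,
      mul_one, Finsupp.single_eq_same, Finsupp.zero_apply] at h
    rw [← h, zero_add]
  have h := congrArg (fun V => coeff V (Sum.inr i) (0, {k}))
    (D.apply_lie_eq_sub (hamiltonian (varMul F i j)) (hamiltonian (varMul F j k)))
  have hdiag : D (hamiltonian (if k = i then varMul F j j else 0)) = 0 := by
    split_ifs
    · exact htorus j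
    · rw [map_zero, map_zero]
  rw [hamiltonian_lie (varMul_mem_oddTrunc ht i j) (varMul_mem_oddTrunc ht j k), TH_varMul_varMul,
    map_sub, map_sub, hdiag, zero_sub, map_neg, map_sub, Pi.neg_apply, Pi.sub_apply,
    coeff_lie_hamiltonian (varMul_mem_oddTrunc ht i j),
    coeff_lie_hamiltonian (varMul_mem_oddTrunc ht j k)] at h
  simp only [hq, hc_varMul, Sum.inr.injEq, hij, if_false, if_true, map_zero, reduceCtorEq, vf_var,
    map_smul, TH_varMul_var_odd, zero_sub, sub_zero, Finsupp.neg_apply, Finsupp.sub_apply,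
    Finsupp.smul_apply, smul_eq_mul] at h
  have hvar : (var (Sum.inr k) : DPS F n) (0, {k}) = 1 := Finsupp.single_eq_same
  rw [hvar] at h
  linear_combination h

theorem exists_sub_adW_hamiltonian_varMul_eq_zero (hp : 5 ≤ p) (hn : 0 < n) (ht : ∀ i, 1 ≤ t i)
    (hD : D ∈ derDeg F p t 0) (hvar : ∀ i, D (hamiltonian (var (Sum.inr i))) = 0)
    (htorus : ∀ i, D (hamiltonian (varMul F i i)) = 0) :
    ∃ E ∈ wittEvenDeg F p t 0,
      (∀ i, (D - adW F p t E) (hamiltonian (var (Sum.inr i))) = 0) ∧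
      ∀ i j, (D - adW F p t E) (hamiltonian (varMul F i j)) = 0 := by
  obtain ⟨q, hq⟩ := exists_coeff_derivation_hamiltonian_varMul hp ht hD hvar htorus
  let o : Fin n := ⟨0, hn⟩
  obtain ⟨E, hE, coeff_E⟩ :=
    exists_mem_wittEvenDeg_zero_coeff_eq_oddDiag (p := p) (t := t) fun i => q o i
  refine ⟨E, hE, fun i => sub_adW_hamiltonian_var_eq_zero coeff_E (hvar i),
    fun i j => coeff_injective (funext fun s => ?_)⟩
  rw [coeff_sub_adW_hamiltonian_varMul ht coeff_E, hq, map_zero, Pi.zero_apply]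
  split_ifs
  · rw [← add_smul, ← varMul_cocycle ht htorus hq o i j, add_sub_assoc', sub_add_eq_sub_sub]
    simp
  · exact add_zero 0

end DegreeZero

section OddMonomials

variable {F : Type*} [Field F] {p : ℕ} [Fact p.Prime] [CharP F p] {n : ℕ} {t : Fin n → ℕ}
  {D : LieDerivation F (hoEven F p t) (wittEven F p t)}

theorem coeff_derivation_odd_single_eq_smul (hp : 5 ≤ p) (ht : ∀ i, 1 ≤ t i)
    (hD : D ∈ derDeg F p t 0) (hvar : ∀ i, D (hamiltonian (var (Sum.inr i))) = 0)
    (htorus : ∀ i, D (hamiltonian (varMul F i i)) = 0) {u : Finset (Fin n)}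
    (hu : #u ≡ 1 [MOD 2]) (s : Ind n) :
    ∃ c : F, coeff (D (hamiltonian (Finsupp.single (0, u) 1))) s =
      c • hc (Finsupp.single (0, u) 1) s := by
  have eq_of_ne_zero : ∀ a, coeff (D (hamiltonian (Finsupp.single (0, u) 1))) s a ≠ 0 →
      ∃ l ∈ u, s = Sum.inl l ∧ a = (0, u.erase l) := fun a h => by
    obtain ⟨ha, -, hs, hw⟩ := weights_of_coeff_derivation_ne_zero hp ht le_rfl hD hvar htorus
      (isOddMono_zero hu) (by simp) h
    exact exists_eq_of_fieldWeight_eq_monoWeight_odd (by simpa using hs.symm) ha hw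
  by_cases hs : ∃ l ∈ u, s = Sum.inl l
  · obtain ⟨l, hl, rfl⟩ := hs
    have hsign : ((1 : F) * (wedgeSign {l} (u.erase l) : ℤ)) ≠ 0 := by
      rw [one_mul]
      exact wedgeSign_cast_ne_zero (by simp)
    refine ⟨-(coeff (D (hamiltonian (Finsupp.single (0, u) 1))) (Sum.inl l) (0, u.erase l) /
      (1 * (wedgeSign {l} (u.erase l) : ℤ))), Finsupp.ext fun a => ?_⟩
    rw [hc_single_inl hu, pd_odd_single, if_pos hl, neg_smul_neg, Finsupp.smul_single, smul_eq_mul,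
      div_mul_cancel₀ _ hsign]
    by_cases ha : (0, u.erase l) = a
    · rw [← ha, Finsupp.single_eq_same]
    · rw [Finsupp.single_eq_of_ne' ha]
      by_contra h
      obtain ⟨k, -, hk, rfl⟩ := eq_of_ne_zero a h
      exact ha (by rw [Sum.inl.inj hk])
  · refine ⟨0, (Finsupp.ext fun a => ?_).trans (zero_smul F _).symm⟩
    by_contra h
    obtain ⟨l, hl, hsl, -⟩ := eq_of_ne_zero a h
    exact hs ⟨l, hl, hsl⟩

theorem coeff_inl_of_varMul_lie_eq_zero (ht : ∀ i, 1 ≤ t i) {i j : Fin n}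
    {V : wittEven F p t} (h : ⁅(hamiltonian (varMul F i j) : hoEven F p t), V⁆ = 0) :
    coeff V (Sum.inl i) = -TH F n (varMul F i j) (coeff V (Sum.inl j)) := by
  have := coeff_lie_hamiltonian (varMul_mem_oddTrunc ht i j) V (Sum.inl j)
  rw [h, map_zero, Pi.zero_apply, hc_varMul, if_pos rfl, map_neg, vf_var, sub_neg_eq_add] at this
  exact (neg_eq_of_add_eq_zero_right this.symm).symm

theorem exists_coeff_derivation_odd_single_eq_smul (hp : 5 ≤ p) (ht : ∀ i, 1 ≤ t i)
    (hD : D ∈ derDeg F p t 0) (hvar : ∀ i, D (hamiltonian (var (Sum.inr i))) = 0)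
    (hlin : ∀ i j, D (hamiltonian (varMul F i j)) = 0) {u : Finset (Fin n)}
    (hu : #u ≡ 1 [MOD 2]) :
    ∃ c : F, ∀ s, coeff (D (hamiltonian (Finsupp.single (0, u) 1))) s =
      c • hc (Finsupp.single (0, u) 1) s := by
  have hxu := single_mem_oddTrunc (isOddMono_zero (p := p) (t := t) hu) (1 : F)
  choose c hc_smul using coeff_derivation_odd_single_eq_smul hp ht hD hvar (fun i => hlin i i) hu
  obtain ⟨j, hj⟩ : u.Nonempty := by
    rw [nonempty_iff_ne_empty]
    rintro rfl
    simp [Nat.ModEq] at hu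
  refine ⟨c (Sum.inl j), fun s => ?_⟩
  rcases s with l | l
  swap
  · rw [hc_smul, hc_single_inr hu]
    simp [pd_even_single]
  rcases eq_or_ne l j with rfl | hlj
  · exact hc_smul _
  have hlie : ⁅(hamiltonian (varMul F l j) : hoEven F p t),
      (hamiltonian (Finsupp.single (0, u) 1) : hoEven F p t)⁆ = 0 := by
    rw [hamiltonian_lie (varMul_mem_oddTrunc ht l j) hxu, TH_varMul_odd_single_eq_zero hlj hj,
      map_zero]
  have hlieD : ⁅(hamiltonian (varMul F l j) : hoEven F p t),
      D (hamiltonian (Finsupp.single (0, u) 1))⁆ = 0 := by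
    have := D.apply_lie_eq_sub (hamiltonian (varMul F l j)) (hamiltonian (Finsupp.single (0, u) 1))
    rwa [hlie, map_zero, hlin, lie_zero, sub_zero, eq_comm] at this
  have hc_inl := coeff_inl_of_varMul_lie_eq_zero ht (congrArg Subtype.val hlie)
  rw [coeff_hamiltonian hxu] at hc_inl
  rw [coeff_inl_of_varMul_lie_eq_zero ht hlieD, hc_smul, map_smul, hc_inl, smul_neg]

theorem exists_sub_adW_hamiltonian_triple_eq_zero (hp : 5 ≤ p) (ht : ∀ i, 1 ≤ t i)
    (hD : D ∈ derDeg F p t 0) (hvar : ∀ i, D (hamiltonian (var (Sum.inr i))) = 0)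
    (hlin : ∀ i j, D (hamiltonian (varMul F i j)) = 0) {u : Finset (Fin n)} (hu : #u = 3) :
    ∃ E ∈ wittEvenDeg F p t 0,
      (∀ i, (D - adW F p t E) (hamiltonian (var (Sum.inr i))) = 0) ∧
      (∀ i j, (D - adW F p t E) (hamiltonian (varMul F i j)) = 0) ∧
      (D - adW F p t E) (hamiltonian (Finsupp.single (0, u) 1)) = 0 := by
  have hodd : #u ≡ 1 [MOD 2] := by rw [hu]; rfl
  have h2 : (2 : F) ≠ 0 := two_ne_zero_of_lt (p := p) (by omega)
  obtain ⟨c, hc_smul⟩ := exists_coeff_derivation_odd_single_eq_smul hp ht hD hvar hlin hodd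
  obtain ⟨E, hE, coeff_E⟩ :=
    exists_mem_wittEvenDeg_zero_coeff_eq_oddDiag (p := p) (t := t) fun _ : Fin n => c / 2
  refine ⟨E, hE, fun i => sub_adW_hamiltonian_var_eq_zero coeff_E (hvar i),
    fun i j => coeff_injective (funext fun s => ?_), coeff_injective (funext fun s => ?_)⟩
  · rw [coeff_sub_adW_hamiltonian_varMul ht coeff_E, hlin]
    simp
  · rw [coeff_sub_adW_hamiltonian_single coeff_E (isOddMono_zero hodd), hc_smul, ← add_smul,
      sum_const, hu, map_zero, Pi.zero_apply]
    rcases s with l | l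
    · have : c + (c / 2 - 3 • (c / 2)) = 0 := by
        rw [nsmul_eq_mul, Nat.cast_ofNat]
        linear_combination -(div_mul_cancel₀ c h2)
      rw [Sum.elim_inl, this, zero_smul]
    · rw [hc_single_inr hodd]
      simp [pd_even_single]

theorem derivation_hamiltonian_triple_eq_zero (ht : ∀ i, 1 ≤ t i)
    (hlin : ∀ i j, D (hamiltonian (varMul F i j)) = 0) {u : Finset (Fin n)} (hu : #u = 3)
    (hDu : D (hamiltonian (Finsupp.single (0, u) 1)) = 0) {v : Finset (Fin n)} (hv : #v = 3) :
    D (hamiltonian (Finsupp.single (0, v) 1)) = 0 := by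
  induction hm : #(v \ u) using Nat.strong_induction_on generalizing v with
  | _ m ih =>
    by_cases hvu : v ⊆ u
    · rwa [eq_of_subset_of_card_le hvu (hu.trans hv.symm).le]
    obtain ⟨j, hj, hju⟩ := not_subset.1 hvu
    obtain ⟨i, hi, hiv⟩ := not_subset.1 fun huv : u ⊆ v =>
      hvu (eq_of_subset_of_card_le huv (hv.trans hu.symm).le).ge
    have hie : i ∉ v.erase j := fun h => hiv (mem_of_mem_erase h)
    have hcard : #(insert i (v.erase j)) = 3 := by
      rw [card_insert_of_notMem hie, card_erase_of_mem hj, hv]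
    have hlt : #(insert i (v.erase j) \ u) < m := by
      rw [← hm, insert_sdiff_of_mem _ hi, erase_sdiff_comm]
      exact card_erase_lt_of_mem (mem_sdiff.2 ⟨hj, hju⟩)
    obtain ⟨c, hc, hTH⟩ := exists_TH_single_apply_single (F := F) (a := (Pi.single i 1, {j}))
      (w := insert i (v.erase j)) (i := i) rfl (mem_insert_self _ _) (by simp)
      (by rw [erase_insert hie]; simp) fun k _ hki h => absurd (Pi.single_eq_of_ne hki 1) h
    rw [tsub_self, erase_insert hie, ← insert_eq, insert_erase hj] at hTH
    exact derivation_hamiltonian_single_eq_zero (isOddMono_single ht i (u := {j}) rfl)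
      (isOddMono_zero (by rw [hcard]; rfl)) hc hTH (hlin i j) (ih _ hlt hcard rfl)

theorem isOddMono_single_add_single (ht : ∀ i, 1 ≤ t i) {i j : Fin n} (hij : i ≠ j)
    {u : Finset (Fin n)} (hu : #u ≡ 1 [MOD 2]) :
    IsOddMono p t (Pi.single i 1 + Pi.single j 1, u) := by
  refine ⟨fun k => ?_, hu⟩
  have := one_le_pow_sub_one (p := p) ht k
  simp only [Pi.add_apply, Pi.single_apply]
  split_ifs <;> omega

theorem derivation_hamiltonian_mixed_eq_zero (hp : 5 ≤ p) (ht : ∀ i, 1 ≤ t i)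
    (hD : D ∈ derDeg F p t 0) (hvar : ∀ i, D (hamiltonian (var (Sum.inr i))) = 0)
    (hlin : ∀ i j, D (hamiltonian (varMul F i j)) = 0) {u : Finset (Fin n)} (hodd : #u ≡ 1 [MOD 2])
    (hu : 1 < #u) (hDu : D (hamiltonian (Finsupp.single (0, u) 1)) = 0) (j : Fin n) :
    D (hamiltonian (Finsupp.single (Pi.single j 1, u) 1)) = 0 := by
  obtain ⟨i, hi, hij⟩ := exists_mem_ne hu j
  have hb : IsOddMono p t (Pi.single i 1 + Pi.single j 1, {i}) :=
    isOddMono_single_add_single ht hij rfl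
  have hquad : D (hamiltonian (Finsupp.single (Pi.single i 1 + Pi.single j 1, {i}) 1)) = 0 := by
    refine derivation_hamiltonian_eq_zero_of_lower hp ht le_rfl hD hvar (fun i => hlin i i) hb
      (fun k hk => ?_) fun _ => by simp [sum_add_distrib]
    rcases eq_or_ne k i with rfl | hki
    · rw [add_tsub_cancel_left]
      exact hlin j k
    · obtain rfl : k = j := by
        by_contra hkj
        simp [hki, hkj] at hk
      rw [add_tsub_cancel_right]
      exact hlin i i
  obtain ⟨c, hc, hTH⟩ := exists_TH_single_apply_single (F := F)
    (a := (Pi.single i 1 + Pi.single j 1, {i})) (w := u) (i := i) rfl hi (by simp) (by simp)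
    fun k _ hki _ => by simpa using ⟨hki.symm, hi⟩
  rw [add_tsub_cancel_left, ← insert_eq, insert_erase hi] at hTH
  exact derivation_hamiltonian_single_eq_zero hb (isOddMono_zero hodd) hc hTH hquad hDu

theorem derivation_hamiltonian_odd_eq_zero (hp : 5 ≤ p) (ht : ∀ i, 1 ≤ t i)
    (hD : D ∈ derDeg F p t 0) (hvar : ∀ i, D (hamiltonian (var (Sum.inr i))) = 0)
    (hlin : ∀ i j, D (hamiltonian (varMul F i j)) = 0)
    (htriple : ∀ u : Finset (Fin n), #u = 3 → D (hamiltonian (Finsupp.single (0, u) 1)) = 0)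
    {u : Finset (Fin n)} (hodd : #u ≡ 1 [MOD 2]) :
    D (hamiltonian (Finsupp.single (0, u) 1)) = 0 := by
  induction hm : #u using Nat.strong_induction_on generalizing u with
  | _ m ih =>
    have hodd' : #u % 2 = 1 := hodd
    rcases lt_or_ge #u 5 with h5 | h5
    · obtain h1 | h3 : #u = 1 ∨ #u = 3 := by omega
      · obtain ⟨i, rfl⟩ := card_eq_one.1 h1
        exact hvar i
      · exact htriple u h3
    obtain ⟨v, hvu, hv⟩ := exists_subset_card_eq (s := u) (n := 3) (by omega)
    have hvodd : #v ≡ 1 [MOD 2] := by rw [hv]; rfl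
    obtain ⟨i, hi⟩ : v.Nonempty := card_pos.1 (by omega)
    have hi' : i ∉ u \ v := fun h => (mem_sdiff.1 h).2 hi
    have hcard : #(insert i (u \ v)) = m - 2 := by
      rw [card_insert_of_notMem hi', card_sdiff_of_subset hvu, hv]
      omega
    have hwodd : #(insert i (u \ v)) ≡ 1 [MOD 2] := by
      rw [hcard, Nat.ModEq]
      omega
    obtain ⟨c, hc, hTH⟩ := exists_TH_single_apply_single (F := F) (a := (Pi.single i 1, v))
      (w := insert i (u \ v)) (i := i) hvodd (mem_insert_self _ _) (by simp)
      (by rw [erase_insert hi']; exact disjoint_sdiff)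
      fun k _ hki h => absurd (Pi.single_eq_of_ne hki 1) h
    rw [tsub_self, erase_insert hi', union_sdiff_of_subset hvu] at hTH
    have hmixed := derivation_hamiltonian_mixed_eq_zero hp ht hD hvar hlin hvodd (by omega)
      (htriple v hv) i
    exact derivation_hamiltonian_single_eq_zero (isOddMono_single ht i hvodd)
      (isOddMono_zero hwodd) hc hTH hmixed (ih (m - 2) (by omega) hwodd hcard)

theorem derivation_eq_zero_of_hamiltonian_triple (hp : 5 ≤ p) (ht : ∀ i, 1 ≤ t i)
    (hD : D ∈ derDeg F p t 0) (hvar : ∀ i, D (hamiltonian (var (Sum.inr i))) = 0)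
    (hlin : ∀ i j, D (hamiltonian (varMul F i j)) = 0) {u : Finset (Fin n)} (hu : #u = 3)
    (hDu : D (hamiltonian (Finsupp.single (0, u) 1)) = 0) : D = 0 := by
  have hodd : ∀ v : Finset (Fin n), #v ≡ 1 [MOD 2] →
      D (hamiltonian (Finsupp.single (0, v) 1)) = 0 := fun v =>
    derivation_hamiltonian_odd_eq_zero hp ht hD hvar hlin
      fun _ => derivation_hamiltonian_triple_eq_zero ht hlin hu hDu
  refine derivation_eq_zero_of_hamiltonian_low hp ht le_rfl hD hvar (fun i => hlin i i)
    fun _ ⟨α, v⟩ hb hα => ?_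
  have hv : #v % 2 = 1 := hb.2
  by_cases h0 : α = 0
  · rw [h0]
    exact hodd v hb.2
  obtain ⟨j, rfl⟩ := exists_eq_single_of_sum_le_one h0 hα
  rcases le_or_gt #v 1 with h1 | h1
  · obtain ⟨i, rfl⟩ := card_eq_one.1 (by omega : #v = 1)
    exact hlin j i
  · exact derivation_hamiltonian_mixed_eq_zero hp ht hD hvar hlin hb.2 h1 (hodd v hb.2) j

end OddMonomials

section Inner

variable {F : Type*} [Field F] {p : ℕ} [Fact p.Prime] [CharP F p] {n : ℕ} {t : Fin n → ℕ}
  {D : LieDerivation F (hoEven F p t) (wittEven F p t)} {d : ℤ}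

theorem mem_map_adW_of_sub_mem {E : wittEven F p t} (hE : E ∈ wittEvenDeg F p t d)
    (h : D - adW F p t E ∈ (wittEvenDeg F p t d).map (adW F p t)) :
    D ∈ (wittEvenDeg F p t d).map (adW F p t) :=
  (Submodule.sub_mem_iff_left _ (Submodule.mem_map_of_mem hE)).1 h

theorem mem_map_adW_of_mem_derDeg_zero (hp : 5 ≤ p) (hn : 3 ≤ n) (ht : ∀ i, 1 ≤ t i)
    (hD : D ∈ derDeg F p t 0) (hvar : ∀ i, D (hamiltonian (var (Sum.inr i))) = 0)
    (htorus : ∀ i, D (hamiltonian (varMul F i i)) = 0) :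
    D ∈ (wittEvenDeg F p t 0).map (adW F p t) := by
  obtain ⟨E, hE, hvarE, hlin⟩ :=
    exists_sub_adW_hamiltonian_varMul_eq_zero hp (by omega) ht hD hvar htorus
  have hDE := sub_mem hD (adW_mem_derDeg hE)
  obtain ⟨u, hu, -⟩ := exists_card_eq_three_mem hn ⟨0, by omega⟩
  obtain ⟨E', hE', hvarE', hlin', htriple⟩ :=
    exists_sub_adW_hamiltonian_triple_eq_zero hp ht hDE hvarE hlin hu
  refine mem_map_adW_of_sub_mem hE (mem_map_adW_of_sub_mem hE' ?_)
  rw [derivation_eq_zero_of_hamiltonian_triple hp ht (sub_mem hDE (adW_mem_derDeg hE')) hvarE'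
    hlin' hu htriple]
  exact zero_mem _

end Inner

end OddHamiltonian

end

open OddHamiltonian in
theorem mainTheorem3 (F : Type*) [Field F] (p : ℕ) [Fact p.Prime] [CharP F p] (hp : 3 < p)
    (n : ℕ) (hn : 3 ≤ n) (t : Fin n → ℕ) (ht : ∀ i, 1 ≤ t i) (d : ℤ) (hd : 0 ≤ d) :
    OddHamiltonian.derDeg F p t d =
      (OddHamiltonian.wittEvenDeg F p t d).map (OddHamiltonian.adW F p t) := by
  have hp5 : 5 ≤ p := Nat.Prime.five_le_of_ne_two_of_ne_three Fact.out (by omega) (by omega)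
  refine le_antisymm (fun D hD => ?_) ?_
  swap
  · rintro _ ⟨E, hE, rfl⟩
    exact adW_mem_derDeg hE
  obtain ⟨E, hE, hvar⟩ := exists_sub_adW_hamiltonian_var_eq_zero (by omega) hn ht hD
  have hDE := sub_mem hD (adW_mem_derDeg hE)
  obtain ⟨E', hE', hvar', htorus⟩ :=
    exists_sub_adW_hamiltonian_varMul_self_eq_zero (by omega) hn ht hDE hvar
  have hDE' := sub_mem hDE (adW_mem_derDeg hE')
  refine mem_map_adW_of_sub_mem hE (mem_map_adW_of_sub_mem hE' ?_)
  rcases hd.eq_or_lt with rfl | hpos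
  · exact mem_map_adW_of_mem_derDeg_zero hp5 hn ht hDE' hvar' htorus
  · rw [derivation_eq_zero_of_hamiltonian_low hp5 ht hd hDE' hvar' htorus
      fun h => absurd h hpos.ne']
    exact zero_mem _
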